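/- Call a set $A\subseteq\mathbb N$ \emph{left-r.e.} if it is the pointwise limit of a uniformly recursive sequence of sets $A_0\le_{\mathrm{lex}}A_1\le_{\mathrm{lex}}\cdots$, where $A\le_{\mathrm{lex}}B$ means that $A=B$ or the least element of $A\triangle B$ lies in $B$. A \emph{left-r.e. numbering} is a map $e\mapsto\alpha_e=\lim_s\alpha_{e,s}$ where $(e,s,n)\mapsto\alpha_{e,s}(n)\in\{0,1\}$ is recursive and $\alpha_{e,s}\le_{\mathrm{lex}}\alpha_{e,s+1}$ for all $e,s$; it is \emph{universal} if every left-r.e. set occurs among the $\alpha_e$. Write $A\subset^*B$ if $A\setminus B$ is finite and $B\setminus A$ is infinite. A left-r.e. set $A$ is \emph{minimal} if $\emptyset\subset^*A$ and there is no left-r.e. set $E$ with $\emptyset\subset^*E\subset^*A$; a left-r.e. set $B$ is \emph{maximal} if $B\subset^*\mathbb N$ and there is no left-r.e. set $E$ with $B\subset^*E\subset^*\mathbb N$. A class $\mathcal C$ of sets \emph{can be made into itself} if $\{e:\beta_e\in\mathcal C\}\in\mathcal C$ for some universal left-r.e. numbering $\beta$. Let $K$ be the halting set and $K'$ its Turing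 jump. \textbf{Theorem.} Let $\alpha$ be any universal left-r.e. numbering, and let $S$ be either $\{e:\alpha_e\text{ is a minimal left-r.e. set}\}$ or $\{e:\alpha_e\text{ is a maximal left-r.e. set}\}$. Then $S$ is not $K'$-recursive (i.e. $S\not\le_{\mathrm T}K'$). Hence $S$ is not left-r.e., and in particular it is neither a minimal nor a maximal left-r.e. set. Consequently, neither the class of minimal left-r.e. sets nor the class of maximal left-r.e. sets can be made into itself. -/

import Mathlib

namespace LeftRE

/-! ### Relative computability of sets of natural numbers -/

open Classical in
/-- The `{0,1}`-valued characteristic function of `A`, as a (total) function `ℕ →. ℕ`. -/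
noncomputable def charFun (A : Set ℕ) : ℕ →. ℕ :=
  fun n => Part.some (if n ∈ A then 1 else 0)

/-- `A` is `B`-recursive, that is, `A` is Turing reducible to `B`. -/
def RecursiveInSet (A B : Set ℕ) : Prop :=
  TuringReducible (charFun A) (charFun B)

/-- The `e`-th partial recursive function `φ_e` in the standard acceptable numbering. -/
def phi (e : ℕ) : ℕ →. ℕ :=
  (Denumerable.ofNat Nat.Partrec.Code e).eval

/-- The halting set `K = {e : φ_e(e) is defined}`. -/
def K : Set ℕ := {e | (phi e e).Dom}

open Classical in
/-- The finite initial segment `A(0) A(1) ... A(n-1)` of the characteristic sequence of `A`. -/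
noncomputable def initSeg (A : Set ℕ) (n : ℕ) : List Bool :=
  (List.range n).map fun i => decide (i ∈ A)

/-- `W_e^X`, the `e`-th set recursively enumerable in `X`: a number `x` is enumerated when the
`e`-th program halts on `x` together with some finite initial segment of the oracle `X` (a halting
oracle computation sees only a finite part of its oracle). -/
def WIn (X : Set ℕ) (e : ℕ) : Set ℕ :=
  {x | ∃ n : ℕ, (phi e (Encodable.encode (x, initSeg X n))).Dom}

/-- The Turing jump `X' = {e : e ∈ W_e^X}`. -/
def jump (X : Set ℕ) : Set ℕ := {e | e ∈ WIn X e}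

/-! ### Left-r.e. sets and their numberings -/

/-- `A ≤_lex B`: either `A = B` or the least element of the symmetric difference is in `B`. -/
def LexLE (A B : Set ℕ) : Prop :=
  A = B ∨ ∃ x, IsLeast (symmDiff A B) x ∧ x ∈ B

/-- The `{0,1}`-valued functions `a 0, a 1, ...` are the characteristic functions of a
`≤_lex`-nondecreasing sequence of sets with limit `A`. -/
def IsLeftApprox (a : ℕ → ℕ → Bool) (A : Set ℕ) : Prop :=
  (∀ s, LexLE {n | a s n = true} {n | a (s + 1) n = true}) ∧
    ∀ n, ∀ᶠ s in Filter.atTop, (a s n = true ↔ n ∈ A)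

/-- `A` is left-r.e.: it has a uniformly recursive `≤_lex`-nondecreasing approximation. -/
def IsLeftRE (A : Set ℕ) : Prop :=
  ∃ a : ℕ → ℕ → Bool, Computable₂ a ∧ IsLeftApprox a A

/-- `α` is a left-r.e. numbering: there are approximations `α_{e,s}`, nondecreasing in `s` and
with limit `α_e`, such that `e, s, n ↦ α_{e,s}(n)` is recursive. -/
def IsLeftRENumbering (α : ℕ → Set ℕ) : Prop :=
  ∃ a : ℕ → ℕ → ℕ → Bool,
    Computable (fun p : ℕ × ℕ × ℕ => a p.1 p.2.1 p.2.2) ∧ ∀ e, IsLeftApprox (a e) (α e)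

/-- A universal left-r.e. numbering is one whose range includes all left-r.e. sets. -/
def IsUniversalNumbering (α : ℕ → Set ℕ) : Prop :=
  IsLeftRENumbering α ∧ ∀ A, IsLeftRE A → ∃ e, α e = A

/-- The `α`-index set of the class `C`. -/
def indexSet (α : ℕ → Set ℕ) (C : Set (Set ℕ)) : Set ℕ := {e | α e ∈ C}

/-- The class `C` can be made into itself: some universal left-r.e. numbering has an index set of
`C` that belongs to `C`. -/
def CanBeMadeIntoItself (C : Set (Set ℕ)) : Prop :=
  ∃ β : ℕ → Set ℕ, IsUniversalNumbering β ∧ indexSet β C ∈ C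

/-! ### Minimal and maximal left-r.e. sets -/

/-- `A ⊂* B`: almost all elements of `A` are in `B` and `B \ A` is infinite. -/
def AlmostSSubset (A B : Set ℕ) : Prop :=
  (A \ B).Finite ∧ (B \ A).Infinite

/-- The class of minimal left-r.e. sets. -/
def minimalLeftRE : Set (Set ℕ) :=
  {A | IsLeftRE A ∧ AlmostSSubset ∅ A ∧
    ¬ ∃ E, IsLeftRE E ∧ AlmostSSubset ∅ E ∧ AlmostSSubset E A}

/-- The class of maximal left-r.e. sets. -/
def maximalLeftRE : Set (Set ℕ) :=
  {B | IsLeftRE B ∧ AlmostSSubset B Set.univ ∧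
    ¬ ∃ E, IsLeftRE E ∧ AlmostSSubset B E ∧ AlmostSSubset E Set.univ}

end LeftRE

namespace LeftRE

/-! ### Compositional computability lemmas -/

attribute [fun_prop] Computable

section Toolkit

variable {α β γ σ : Type*} [Primcodable α] [Primcodable β] [Primcodable γ] [Primcodable σ]

/-! The diagonal set {e : `UnivSigma3 e e`} is Σ₃ and its complement is not
(`not_isSigma3_not_univSigma3`). The core, `exists_numbering`, is a left-r.e. numbering γ for which
γ_e is minimal (`ν = false`) or maximal (`ν = true`) exactly when `UnivSigma3 e e`. Since α is
universal, `¬ UnivSigma3 e e` holds iff α_d = γ_e for some d ∉ S. This equality is Π₂ in the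
indices, so the complement of S cannot be Σ₃. It would be Σ₃ if S were K'-recursive, because K' is
Δ₃, and also if S were left-r.e., because S would then be a recursive limit.

For γ, divide ℕ into blocks, each holding one movable marker. Moving a marker to a lower place
increases the set lexicographically, and this pays for resetting all later markers to higher places.
Suppose that α_e, with e ≤ n, currently misses block n and meets block n + 1 exactly in its marker.
Then marker n moves down, once for each content of α_e before block n, and marker n + 1 jumps up.
Being left-r.e., α_e cannot return to the same content before block n and again contain only the
(now lexicographically smaller) marker of block n + 1. Hence no left-r.e. set almost contained in
the set of final markers drops one marker and picks up the next one far out. If it is infinite, it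
contains almost all markers (`false_of_split`, `finite_markerSet_diff`).

Block n of γ_e holds just its marker when n is a deficiency stage of `column e`, and two other
elements otherwise. In the Σ₃ case almost all n are deficient and γ_e is almost the set of markers,
hence minimal. Otherwise deleting the second element of every pair gives a left-r.e. set strictly
between ∅ and γ_e. The maximal case is the complement of this picture; reversing each block makes
lower places lexicographically larger again. -/

@[fun_prop]
theorem computable_id' : Computable (fun a : α => a) := Computable.id

@[fun_prop]
theorem computable_const' (b : β) : Computable (fun _ : α => b) := Computable.const b

@[fun_prop]
theorem computable_comp' {f : β → γ} {g : α → β} (hf : Computable f) (hg : Computable g) :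
    Computable (fun x => f (g x)) := hf.comp hg

@[fun_prop]
theorem computable_fst' {f : α → β × γ} (hf : Computable f) : Computable (fun x => (f x).1) :=
  Computable.fst.comp hf

@[fun_prop]
theorem computable_snd' {f : α → β × γ} (hf : Computable f) : Computable (fun x => (f x).2) :=
  Computable.snd.comp hf

@[fun_prop]
theorem computable_mk {f : α → β} {g : α → γ} (hf : Computable f) (hg : Computable g) :
    Computable (fun x => (f x, g x)) := hf.pair hg

@[fun_prop]
theorem computable_natAdd {f g : α → ℕ} (hf : Computable f) (hg : Computable g) :
    Computable (fun x => f x + g x) := Primrec.nat_add.to_comp.comp hf hg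

@[fun_prop]
theorem computable_natSub {f g : α → ℕ} (hf : Computable f) (hg : Computable g) :
    Computable (fun x => f x - g x) := Primrec.nat_sub.to_comp.comp hf hg

@[fun_prop]
theorem computable_natMul {f g : α → ℕ} (hf : Computable f) (hg : Computable g) :
    Computable (fun x => f x * g x) := Primrec.nat_mul.to_comp.comp hf hg

@[fun_prop]
theorem computable_natPow {f g : α → ℕ} (hf : Computable f) (hg : Computable g) :
    Computable (fun x => f x ^ g x) :=
  (Primrec₂.unpaired'.1 Nat.Primrec.pow).to_comp.comp hf hg

@[fun_prop]
theorem computable_natPair {f g : α → ℕ} (hf : Computable f) (hg : Computable g) :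
    Computable (fun x => Nat.pair (f x) (g x)) := Primrec₂.natPair.to_comp.comp hf hg

@[fun_prop]
theorem computable_natUnpair {f : α → ℕ} (hf : Computable f) :
    Computable (fun x => (f x).unpair) := Computable.unpair.comp hf

@[fun_prop]
theorem computable_beq {f g : α → ℕ} (hf : Computable f) (hg : Computable g) :
    Computable (fun x => f x == g x) := Primrec.beq.to_comp.comp hf hg

@[fun_prop]
theorem computable_ble {f g : α → ℕ} (hf : Computable f) (hg : Computable g) :
    Computable (fun x => Nat.ble (f x) (g x)) :=
  (Primrec.nat_le.decide.to_comp.comp hf hg).of_eq fun x => by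
    rw [Bool.eq_iff_iff, Nat.ble_eq, decide_eq_true_eq]

@[fun_prop]
theorem computable_boolAnd {f g : α → Bool} (hf : Computable f) (hg : Computable g) :
    Computable (fun x => f x && g x) := Primrec.and.to_comp.comp hf hg

@[fun_prop]
theorem computable_boolOr {f g : α → Bool} (hf : Computable f) (hg : Computable g) :
    Computable (fun x => f x || g x) := Primrec.or.to_comp.comp hf hg

@[fun_prop]
theorem computable_boolNot {f : α → Bool} (hf : Computable f) :
    Computable (fun x => !f x) := Primrec.not.to_comp.comp hf

@[fun_prop]
theorem computable_boolXor {f g : α → Bool} (hf : Computable f) (hg : Computable g) :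
    Computable (fun x => xor (f x) (g x)) := (Primrec.dom_bool₂ xor).to_comp.comp hf hg

@[fun_prop]
theorem computable_cond {c : α → Bool} {f g : α → σ} (hc : Computable c) (hf : Computable f)
    (hg : Computable g) : Computable (fun x => bif c x then f x else g x) := hc.cond hf hg

@[fun_prop]
theorem computable_isSome {f : α → Option β} (hf : Computable f) :
    Computable (fun x => (f x).isSome) := Primrec.option_isSome.to_comp.comp hf

@[fun_prop]
theorem computable_cons {f : α → β} {g : α → List β} (hf : Computable f) (hg : Computable g) :
    Computable (fun x => f x :: g x) := Computable.list_cons.comp hf hg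

@[fun_prop]
theorem computable_ofNat_list {f : α → ℕ} (hf : Computable f) :
    Computable (fun x => Denumerable.ofNat (List ℕ) (f x)) := (Computable.ofNat (List ℕ)).comp hf

@[fun_prop]
theorem computable_getD_zero {f : α → List ℕ} {g : α → ℕ} (hf : Computable f)
    (hg : Computable g) : Computable (fun x => (f x).getD (g x) 0) :=
  (Primrec.list_getD 0).to_comp.comp hf hg

@[fun_prop]
theorem computable_evaln {k c n : α → ℕ} (hk : Computable k) (hc : Computable c)
    (hn : Computable n) : Computable (fun x =>
      Nat.Partrec.Code.evaln (k x) (Denumerable.ofNat Nat.Partrec.Code (c x)) (n x)) :=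
  Nat.Partrec.Code.primrec_evaln.to_comp.comp
    ((hk.pair ((Computable.ofNat Nat.Partrec.Code).comp hc)).pair hn)

theorem computable_natRec {f : α → ℕ} {g : α → σ} {h : α → ℕ → σ → σ} (hf : Computable f)
    (hg : Computable g) (hh : Computable fun p : α × ℕ × σ => h p.1 p.2.1 p.2.2) :
    Computable fun x => (Nat.rec (g x) (fun n ih => h x n ih) (f x) : σ) :=
  Computable.nat_rec (h := fun x p => h x p.1 p.2) hf hg hh

/-- Whether some number below `n` satisfies `p`. -/
def anyBelow (n : ℕ) (p : ℕ → Bool) : Bool := Nat.rec false (fun i b => b || p i) n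

theorem anyBelow_eq_true {n : ℕ} {p : ℕ → Bool} :
    anyBelow n p = true ↔ ∃ i < n, p i = true := by
  induction n with
  | zero => simp [anyBelow]
  | succ n ih =>
    have : anyBelow (n + 1) p = (anyBelow n p || p n) := rfl
    rw [this, Bool.or_eq_true, ih]
    constructor
    · rintro (⟨i, hi, h⟩ | h)
      exacts [⟨i, by omega, h⟩, ⟨n, by omega, h⟩]
    · rintro ⟨i, hi, h⟩
      rcases Nat.lt_succ_iff_lt_or_eq.1 hi with h' | rfl
      · exact .inl ⟨i, h', h⟩
      · exact .inr h

theorem computable_anyBelow {f : α → ℕ} {p : α → ℕ → Bool} (hf : Computable f)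
    (hp : Computable fun x : α × ℕ => p x.1 x.2) :
    Computable fun x => anyBelow (f x) (p x) := by
  refine computable_natRec (h := fun x i b => b || p x i) hf (by fun_prop) ?_
  have : Computable fun q : α × ℕ × Bool => p q.1 q.2.1 :=
    hp.comp (f := fun x : α × ℕ => p x.1 x.2) (g := fun q : α × ℕ × Bool => (q.1, q.2.1))
      (by fun_prop)
  fun_prop

end Toolkit

/-! ### Arithmetical predicates -/

section Arithmetical

variable {α β : Type*} [Primcodable α] [Primcodable β]

/-- Predicates of the form `∀ y, ∃ z, R` with `R` recursive. -/
def IsPi2 (Q : α → Prop) : Prop :=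
  ∃ R : α × ℕ × ℕ → Bool, Computable R ∧ ∀ a, Q a ↔ ∀ y, ∃ z, R (a, y, z) = true

/-- Predicates of the form `∃ x, ∀ y, ∃ z, R` with `R` recursive. -/
def IsSigma3 (Q : α → Prop) : Prop :=
  ∃ R : α × ℕ → Prop, IsPi2 R ∧ ∀ a, Q a ↔ ∃ x, R (a, x)

namespace IsPi2

theorem of_computable {f : α → Bool} (hf : Computable f) : IsPi2 fun a => f a = true :=
  ⟨fun p => f p.1, by fun_prop, fun a => by simp⟩

theorem exists_computable {f : α × ℕ → Bool} (hf : Computable f) :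
    IsPi2 fun a => ∃ z, f (a, z) = true :=
  ⟨fun p => f (p.1, p.2.2), by fun_prop, fun a => by simp⟩

theorem comp {Q : β → Prop} (hQ : IsPi2 Q) {f : α → β} (hf : Computable f) :
    IsPi2 fun a => Q (f a) := by
  obtain ⟨R, hR, h⟩ := hQ
  exact ⟨fun p => R (f p.1, p.2), by fun_prop, fun a => h _⟩

theorem and {Q Q' : α → Prop} (hQ : IsPi2 Q) (hQ' : IsPi2 Q') : IsPi2 fun a => Q a ∧ Q' a := by
  obtain ⟨R, hR, h⟩ := hQ
  obtain ⟨R', hR', h'⟩ := hQ'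
  refine ⟨fun p => R (p.1, p.2.1, p.2.2.unpair.1) && R' (p.1, p.2.1, p.2.2.unpair.2),
    by fun_prop, fun a => ?_⟩
  change Q a ∧ Q' a ↔ _
  rw [h, h', ← forall_and]
  refine forall_congr' fun y => ⟨?_, ?_⟩
  · rintro ⟨⟨z, hz⟩, ⟨z', hz'⟩⟩
    exact ⟨Nat.pair z z', by simp [hz, hz']⟩
  · rintro ⟨z, hz⟩
    rw [Bool.and_eq_true] at hz
    exact ⟨⟨_, hz.1⟩, ⟨_, hz.2⟩⟩

theorem all {Q : α × ℕ → Prop} (hQ : IsPi2 Q) : IsPi2 fun a => ∀ b, Q (a, b) := by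
  obtain ⟨R, hR, h⟩ := hQ
  refine ⟨fun p => R ((p.1, p.2.1.unpair.1), p.2.1.unpair.2, p.2.2), by fun_prop, fun a => ?_⟩
  simp only [h]
  exact ⟨fun H y => H _ _, fun H b y => by simpa using H (Nat.pair b y)⟩

theorem imp {f : α → Bool} (hf : Computable f) {Q : α → Prop} (hQ : IsPi2 Q) :
    IsPi2 fun a => f a = true → Q a := by
  obtain ⟨R, hR, h⟩ := hQ
  refine ⟨fun p => !f p.1 || R p, by fun_prop, fun a => ?_⟩
  cases hfa : f a <;> simp [h, hfa]

end IsPi2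

theorem IsPi2.isSigma3 {Q : α → Prop} (hQ : IsPi2 Q) : IsSigma3 Q :=
  ⟨fun p => Q p.1, hQ.comp (by fun_prop), fun a => by simp⟩

namespace IsSigma3

theorem of_computable {f : α → Bool} (hf : Computable f) : IsSigma3 fun a => f a = true :=
  (IsPi2.of_computable hf).isSigma3

theorem congr {Q Q' : α → Prop} (hQ : IsSigma3 Q) (h : ∀ a, Q' a ↔ Q a) : IsSigma3 Q' := by
  rwa [funext fun a => propext (h a)]

theorem comp {Q : β → Prop} (hQ : IsSigma3 Q) {f : α → β} (hf : Computable f) :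
    IsSigma3 fun a => Q (f a) := by
  obtain ⟨R, hR, h⟩ := hQ
  exact ⟨fun p => R (f p.1, p.2), hR.comp (by fun_prop), fun a => h _⟩

theorem ex {Q : α × ℕ → Prop} (hQ : IsSigma3 Q) : IsSigma3 fun a => ∃ b, Q (a, b) := by
  obtain ⟨R, hR, h⟩ := hQ
  refine ⟨fun p => R ((p.1, p.2.unpair.1), p.2.unpair.2), hR.comp (by fun_prop), fun a => ?_⟩
  simp only [h]
  exact ⟨fun ⟨b, x, H⟩ => ⟨Nat.pair b x, by simpa using H⟩, fun ⟨x, H⟩ => ⟨_, _, H⟩⟩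

theorem and {Q Q' : α → Prop} (hQ : IsSigma3 Q) (hQ' : IsSigma3 Q') :
    IsSigma3 fun a => Q a ∧ Q' a := by
  obtain ⟨R, hR, h⟩ := hQ
  obtain ⟨R', hR', h'⟩ := hQ'
  refine ⟨fun p => R (p.1, p.2.unpair.1) ∧ R' (p.1, p.2.unpair.2),
    (hR.comp (f := fun p : α × ℕ => (p.1, p.2.unpair.1)) (by fun_prop)).and
      (hR'.comp (f := fun p : α × ℕ => (p.1, p.2.unpair.2)) (by fun_prop)), fun a => ?_⟩
  change Q a ∧ Q' a ↔ _
  rw [h, h']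
  exact ⟨fun ⟨⟨x, H⟩, ⟨x', H'⟩⟩ => ⟨Nat.pair x x', by simpa using ⟨H, H'⟩⟩,
    fun ⟨x, H, H'⟩ => ⟨⟨_, H⟩, ⟨_, H'⟩⟩⟩

theorem or {Q Q' : α → Prop} (hQ : IsSigma3 Q) (hQ' : IsSigma3 Q') :
    IsSigma3 fun a => Q a ∨ Q' a := by
  obtain ⟨R, hR, h⟩ := hQ
  obtain ⟨R', hR', h'⟩ := hQ'
  -- The first half of the witness is a tag: 0 selects the first disjunct, anything else the second.
  -- Decidable implications keep the matrix Π₂.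
  refine ⟨fun p => ((p.2.unpair.1 == 0) = true → R (p.1, p.2.unpair.2)) ∧
      ((!(p.2.unpair.1 == 0)) = true → R' (p.1, p.2.unpair.2)),
    (IsPi2.imp (f := fun p : α × ℕ => (p.2.unpair.1 == 0)) (by fun_prop)
      (hR.comp (f := fun p : α × ℕ => (p.1, p.2.unpair.2)) (by fun_prop))).and
      (IsPi2.imp (f := fun p : α × ℕ => !(p.2.unpair.1 == 0)) (by fun_prop)
        (hR'.comp (f := fun p : α × ℕ => (p.1, p.2.unpair.2))
        (by fun_prop))), fun a => ?_⟩
  change Q a ∨ Q' a ↔ _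
  rw [h, h']
  constructor
  · rintro (⟨x, H⟩ | ⟨x, H⟩)
    · exact ⟨Nat.pair 0 x, by simpa using H⟩
    · exact ⟨Nat.pair 1 x, by simpa using H⟩
  · rintro ⟨x, H, H'⟩
    by_cases h0 : x.unpair.1 = 0
    · exact .inl ⟨_, H (by simpa using h0)⟩
    · exact .inr ⟨_, H' (by simpa using h0)⟩

/-- Finitely many natural numbers can be given by a code of a list. -/
theorem exists_list (n : ℕ) {P : ℕ → ℕ → Prop} (h : ∀ i < n, ∃ x, P i x) :
    ∃ l : ℕ, ∀ i < n, P i ((Denumerable.ofNat (List ℕ) l).getD i 0) := by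
  choose! g hg using h
  refine ⟨Encodable.encode ((List.range n).map g), fun i hi => ?_⟩
  simpa [hi, List.getD_eq_getElem] using hg i hi

/-- The finitely many outer witnesses fit into one list code, so the outer ∃ can be pulled in front
of the bounded ∀, which the Π₂ matrix absorbs. -/
theorem ball {Q : α × ℕ → Prop} (hQ : IsSigma3 Q) {n : α → ℕ} (hn : Computable n) :
    IsSigma3 fun a => ∀ i < n a, Q (a, i) := by
  obtain ⟨R, hR, h⟩ := hQ
  refine ⟨fun p => ∀ i, Nat.ble (i + 1) (n p.1) = true →
      R ((p.1, i), (Denumerable.ofNat (List ℕ) p.2).getD i 0),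
    IsPi2.all (Q := fun q : (α × ℕ) × ℕ => Nat.ble (q.2 + 1) (n q.1.1) = true →
      R ((q.1.1, q.2), (Denumerable.ofNat (List ℕ) q.1.2).getD q.2 0))
      (IsPi2.imp (f := fun q : (α × ℕ) × ℕ => Nat.ble (q.2 + 1) (n q.1.1)) (by fun_prop)
        (hR.comp (f := fun q : (α × ℕ) × ℕ =>
          ((q.1.1, q.2), (Denumerable.ofNat (List ℕ) q.1.2).getD q.2 0)) (by fun_prop))), fun a => ?_⟩
  simp only [h, Nat.ble_eq, Nat.succ_le_iff]
  exact ⟨fun H => exists_list _ H, fun ⟨l, H⟩ i hi => ⟨_, H i hi⟩⟩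

end IsSigma3

/-- The graph of a partial function that is recursive in `O` is `Σ₃` if this is so for all
elements of `O`. -/
theorem isSigma3_graph {O : Set (ℕ →. ℕ)}
    (hO : ∀ g ∈ O, IsSigma3 fun p : ℕ × ℕ => p.2 ∈ g p.1) {f : ℕ →. ℕ}
    (hf : Nat.RecursiveIn O f) : IsSigma3 fun p : ℕ × ℕ => p.2 ∈ f p.1 := by
  induction hf with
  | zero =>
    refine (IsSigma3.of_computable (f := fun p : ℕ × ℕ => (p.2 == 0))
      (by fun_prop)).congr fun a => ?_
    simp [show (0 : Part ℕ) = Part.some 0 from rfl]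
  | succ =>
    refine (IsSigma3.of_computable (f := fun p : ℕ × ℕ => (p.2 == p.1 + 1))
      (by fun_prop)).congr fun a => ?_
    simp
  | left =>
    refine (IsSigma3.of_computable (f := fun p : ℕ × ℕ => (p.2 == p.1.unpair.1))
      (by fun_prop)).congr fun a => ?_
    simp
  | right =>
    refine (IsSigma3.of_computable (f := fun p : ℕ × ℕ => (p.2 == p.1.unpair.2))
      (by fun_prop)).congr fun a => ?_
    simp
  | oracle g hg => exact hO g hg
  | @pair f h _ _ ihf ihh =>
    refine (IsSigma3.ex (Q := fun q : (ℕ × ℕ) × ℕ =>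
      ((q.1.2 == Nat.pair q.2.unpair.1 q.2.unpair.2) = true ∧ q.2.unpair.1 ∈ f q.1.1) ∧
        q.2.unpair.2 ∈ h q.1.1)
      (((IsSigma3.of_computable (f := fun q : (ℕ × ℕ) × ℕ =>
        (q.1.2 == Nat.pair q.2.unpair.1 q.2.unpair.2)) (by fun_prop)).and
        (ihf.comp (f := fun q : (ℕ × ℕ) × ℕ => (q.1.1, q.2.unpair.1)) (by fun_prop))).and
        (ihh.comp (f := fun q : (ℕ × ℕ) × ℕ => (q.1.1, q.2.unpair.2)) (by fun_prop)))).congr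
      fun a => ?_
    simp only [Seq.seq, Functor.map, Part.mem_bind_iff, Part.mem_map_iff,
      beq_iff_eq]
    constructor
    · rintro ⟨_, ⟨u, hu, rfl⟩, w, hw, hw'⟩
      exact ⟨Nat.pair u w, by simpa [hu, hw] using hw'.symm⟩
    · rintro ⟨b, ⟨hb, hb1⟩, hb2⟩
      exact ⟨_, ⟨_, hb1, rfl⟩, _, hb2, hb.symm⟩
  | @comp f h _ _ ihf ihh =>
    refine (IsSigma3.ex (Q := fun q : (ℕ × ℕ) × ℕ => q.2 ∈ h q.1.1 ∧ q.1.2 ∈ f q.2)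
      ((ihh.comp (f := fun q : (ℕ × ℕ) × ℕ => (q.1.1, q.2)) (by fun_prop)).and
        (ihf.comp (f := fun q : (ℕ × ℕ) × ℕ => (q.2, q.1.2)) (by fun_prop)))).congr fun a => ?_
    exact Part.mem_bind_iff
  | @prec f h _ _ ihf ihh =>
    -- The existential witness codes the whole history of the recursion, one entry for each
    -- intermediate value.
    refine (IsSigma3.ex (Q := fun q : (ℕ × ℕ) × ℕ =>
      (((q.1.2 == (Denumerable.ofNat (List ℕ) q.2).getD q.1.1.unpair.2 0) = true ∧
        (Denumerable.ofNat (List ℕ) q.2).getD 0 0 ∈ f q.1.1.unpair.1)) ∧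
        ∀ i < q.1.1.unpair.2, (Denumerable.ofNat (List ℕ) q.2).getD (i + 1) 0 ∈
          h (Nat.pair q.1.1.unpair.1 (Nat.pair i ((Denumerable.ofNat (List ℕ) q.2).getD i 0))))
      (((IsSigma3.of_computable (f := fun q : (ℕ × ℕ) × ℕ => (q.1.2 ==
        (Denumerable.ofNat (List ℕ) q.2).getD q.1.1.unpair.2 0)) (by fun_prop)).and
        (ihf.comp (f := fun q : (ℕ × ℕ) × ℕ =>
          (q.1.1.unpair.1, (Denumerable.ofNat (List ℕ) q.2).getD 0 0)) (by fun_prop))).and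
        (IsSigma3.ball (Q := fun r : ((ℕ × ℕ) × ℕ) × ℕ =>
          (Denumerable.ofNat (List ℕ) r.1.2).getD (r.2 + 1) 0 ∈ h (Nat.pair r.1.1.1.unpair.1
            (Nat.pair r.2 ((Denumerable.ofNat (List ℕ) r.1.2).getD r.2 0))))
          (ihh.comp (f := fun r : ((ℕ × ℕ) × ℕ) × ℕ => (Nat.pair r.1.1.1.unpair.1
            (Nat.pair r.2 ((Denumerable.ofNat (List ℕ) r.1.2).getD r.2 0)),
            (Denumerable.ofNat (List ℕ) r.1.2).getD (r.2 + 1) 0)) (by fun_prop))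
          (n := fun q : (ℕ × ℕ) × ℕ => q.1.1.unpair.2) (by fun_prop)))).congr fun a => ?_
    obtain ⟨p, y⟩ := a
    simp only [beq_iff_eq]
    generalize p.unpair.1 = a
    generalize p.unpair.2 = n
    constructor
    · intro hy
      have key : ∃ g : ℕ → ℕ, y = g n ∧ g 0 ∈ f a ∧
          ∀ i < n, g (i + 1) ∈ h (Nat.pair a (Nat.pair i (g i))) := by
        induction n generalizing y with
        | zero => exact ⟨fun _ => y, rfl, hy, by simp⟩
        | succ n ih =>
          obtain ⟨u, hu, hu'⟩ := Part.mem_bind_iff.1 hy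
          obtain ⟨g, rfl, hg0, hg⟩ := ih u hu
          refine ⟨fun i => if i = n + 1 then y else g i, by simp, by simpa using hg0,
            fun i hi => ?_⟩
          rcases Nat.lt_succ_iff_lt_or_eq.1 hi with h' | rfl
          · have h1 : i ≠ n := by omega
            have h2 : i ≠ n + 1 := by omega
            simpa [h1, h2] using hg i h'
          · simpa using hu'
      obtain ⟨g, rfl, hg0, hg⟩ := key
      have hl : ∀ i ≤ n, (Denumerable.ofNat (List ℕ)
          (Encodable.encode ((List.range (n + 1)).map g))).getD i 0 = g i := fun i hi => by
        simp [Nat.lt_succ_of_le hi]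
      refine ⟨Encodable.encode ((List.range (n + 1)).map g), ⟨(hl n le_rfl).symm, ?_⟩,
        fun i hi => ?_⟩
      · rwa [hl 0 (Nat.zero_le _)]
      · rw [hl _ hi, hl _ hi.le]
        exact hg i hi
    · rintro ⟨l, ⟨rfl, h0⟩, hl⟩
      induction n with
      | zero => exact h0
      | succ n ih =>
        exact Part.mem_bind_iff.2 ⟨_, ih fun i hi => hl i (by omega), hl n (by omega)⟩
  | @rfind f _ ihf =>
    -- All earlier values must be defined and nonzero. Asking for a value `b + 1` says this
    -- positively, as a Σ₃ condition on the graph.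
    refine ((ihf.comp (f := fun q : ℕ × ℕ => (Nat.pair q.1 q.2, 0)) (by fun_prop)).and
      (IsSigma3.ball (Q := fun r : (ℕ × ℕ) × ℕ => ∃ b, b + 1 ∈ f (Nat.pair r.1.1 r.2))
        (IsSigma3.ex (Q := fun r : ((ℕ × ℕ) × ℕ) × ℕ => r.2 + 1 ∈ f (Nat.pair r.1.1.1 r.1.2))
          (ihf.comp (f := fun r : ((ℕ × ℕ) × ℕ) × ℕ => (Nat.pair r.1.1.1 r.1.2, r.2 + 1))
            (by fun_prop))) (n := fun q => q.2) (by fun_prop))).congr fun a => ?_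
    obtain ⟨a, y⟩ := a
    refine Nat.mem_rfind.trans ?_
    simp only [Functor.map, Part.mem_map_iff, decide_eq_true_eq, decide_eq_false_iff_not]
    refine and_congr ⟨fun ⟨u, hu, h0⟩ => h0 ▸ hu, fun h => ⟨0, h, rfl⟩⟩
      (forall_congr' fun i => forall_congr' fun _ => ⟨?_, ?_⟩)
    · rintro ⟨u, hu, h0⟩
      obtain ⟨b, rfl⟩ := Nat.exists_eq_succ_of_ne_zero h0
      exact ⟨b, hu⟩
    · rintro ⟨b, hb⟩
      exact ⟨_, hb, by omega⟩

end Arithmetical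

open Nat.Partrec (Code)
open Filter

/-! ### The double jump is `Δ₃` -/

theorem phi_dom_iff {e n : ℕ} :
    (phi e n).Dom ↔ ∃ z, (Code.evaln z (Denumerable.ofNat Code e) n).isSome = true := by
  simp only [phi, Part.dom_iff_mem, Code.evaln_complete, Option.isSome_iff_exists,
    Option.mem_def]
  exact exists_comm

theorem isSome_evaln_mono {z z' n : ℕ} {c : Code} (h : z ≤ z')
    (hz : (Code.evaln z c n).isSome = true) : (Code.evaln z' c n).isSome = true := by
  obtain ⟨x, hx⟩ := Option.isSome_iff_exists.1 hz
  exact Option.isSome_iff_exists.2 ⟨x, Code.evaln_mono h hx⟩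

/-- The first `n` bits of the stage `t` approximation of `K`. -/
def segK (t n : ℕ) : List Bool :=
  (List.range n).map fun i => (Code.evaln t (Denumerable.ofNat Code i) i).isSome

theorem eventually_segK (n : ℕ) : ∀ᶠ t in atTop, segK t n = initSeg K n := by
  classical
  have : ∀ i ∈ Finset.range n, ∀ᶠ t in atTop,
      (Code.evaln t (Denumerable.ofNat Code i) i).isSome = true ↔ i ∈ K := by
    intro i _
    by_cases hi : i ∈ K
    · obtain ⟨z, hz⟩ := phi_dom_iff.1 hi
      filter_upwards [eventually_ge_atTop z] with t ht
      simp [hi, isSome_evaln_mono ht hz]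
    · refine Eventually.of_forall fun t => ⟨fun h => (hi ?_).elim, fun h => (hi h).elim⟩
      exact phi_dom_iff.2 ⟨t, h⟩
  filter_upwards [(eventually_all_finset _).2 this] with t ht
  refine List.map_congr_left fun i hi => ?_
  rw [Bool.eq_iff_iff, ht i (by simpa using hi), decide_eq_true_eq]

/-- Whether the oracle program `e` halts on `e` within `z` steps, using `n` bits of the stage `t`
approximation of `K`. -/
def haltsApprox (e n z t : ℕ) : Bool :=
  (Code.evaln z (Denumerable.ofNat Code e) (Nat.pair e (Encodable.encode (segK t n)))).isSome

theorem computable_haltsApprox {α : Type*} [Primcodable α] {e n z t : α → ℕ} (he : Computable e)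
    (hn : Computable n) (hz : Computable z) (ht : Computable t) :
    Computable fun a => haltsApprox (e a) (n a) (z a) (t a) := by
  have h1 : Primrec fun q : ℕ × ℕ => segK q.1 q.2 := by
    refine Primrec.list_map (Primrec.list_range.comp Primrec.snd) ?_
    exact Primrec.option_isSome.comp (Code.primrec_evaln.comp
      ((((Primrec.fst.comp Primrec.fst).pair ((Primrec.ofNat Code).comp Primrec.snd))).pair
        Primrec.snd))
  have h2 : Computable fun a => Encodable.encode (segK (t a) (n a)) :=
    (Primrec.encode.comp h1).to_comp.comp (ht.pair hn)
  unfold haltsApprox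
  fun_prop

/-- For fixed `n` the approximations of the first `n` bits of K stabilise. Thus "at infinitely many
stages" says the same as "for the true bits", both here and in the negated version below, and it is
Π₂. -/
theorem mem_jump_K {e : ℕ} :
    e ∈ jump K ↔ ∃ n, ∃ z, ∀ t, ∃ d, haltsApprox e n z (t + d) = true := by
  change (∃ n, (phi e (Nat.pair e (Encodable.encode (initSeg K n)))).Dom) ↔ _
  refine exists_congr fun n => ?_
  rw [phi_dom_iff]
  refine exists_congr fun z => ?_
  obtain ⟨t₀, ht₀⟩ := eventually_atTop.1 (eventually_segK n)
  constructor
  · intro h t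
    refine ⟨t₀, ?_⟩
    rwa [haltsApprox, ht₀ _ (by omega)]
  · intro h
    obtain ⟨d, hd⟩ := h t₀
    rwa [haltsApprox, ht₀ _ (by omega)] at hd

theorem notMem_jump_K {e : ℕ} :
    e ∉ jump K ↔ ∀ n, ∀ z, ∀ t, ∃ d, (!haltsApprox e n z (t + d)) = true := by
  rw [mem_jump_K]
  push Not
  refine forall_congr' fun n => forall_congr' fun z => ?_
  obtain ⟨t₀, ht₀⟩ := eventually_atTop.1 (eventually_segK n)
  have key : ∀ t, t₀ ≤ t → haltsApprox e n z t = haltsApprox e n z t₀ := fun t ht => by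
    rw [haltsApprox, haltsApprox, ht₀ _ ht, ht₀ _ le_rfl]
  constructor
  · rintro ⟨t, ht⟩ t'
    refine ⟨t + t₀, ?_⟩
    have h1 := ht t₀
    rw [key _ (by omega)] at h1
    rw [key _ (by omega)]
    simpa using h1
  · intro h
    refine ⟨t₀, fun d => ?_⟩
    obtain ⟨d', hd'⟩ := h t₀
    rw [key _ (by omega)] at hd' ⊢
    simpa using hd'

theorem isSigma3_mem_jump_K : IsSigma3 fun e => e ∈ jump K := by
  have h : IsPi2 fun q : (ℕ × ℕ) × ℕ => ∀ t, ∃ d, haltsApprox q.1.1 q.1.2 q.2 (t + d) = true := by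
    refine IsPi2.all (Q := fun r : ((ℕ × ℕ) × ℕ) × ℕ =>
      ∃ d, haltsApprox r.1.1.1 r.1.1.2 r.1.2 (r.2 + d) = true) ?_
    exact IsPi2.exists_computable (f := fun r : (((ℕ × ℕ) × ℕ) × ℕ) × ℕ =>
      haltsApprox r.1.1.1.1 r.1.1.1.2 r.1.1.2 (r.1.2 + r.2))
      (computable_haltsApprox (by fun_prop) (by fun_prop) (by fun_prop) (by fun_prop))
  exact (h.isSigma3.ex.ex).congr fun e => mem_jump_K

theorem isSigma3_notMem_jump_K : IsSigma3 fun e => e ∉ jump K := by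
  have h : IsPi2 fun r : ((ℕ × ℕ) × ℕ) × ℕ =>
      ∃ d, (!haltsApprox r.1.1.1 r.1.1.2 r.1.2 (r.2 + d)) = true := by
    refine IsPi2.exists_computable (f := fun r : (((ℕ × ℕ) × ℕ) × ℕ) × ℕ =>
      !haltsApprox r.1.1.1.1 r.1.1.1.2 r.1.1.2 (r.1.2 + r.2)) (computable_boolNot ?_)
    exact computable_haltsApprox (by fun_prop) (by fun_prop) (by fun_prop) (by fun_prop)
  exact (h.all.all.all.isSigma3).congr fun e => notMem_jump_K

/-- The jump of K and its complement are both Σ₃, so the graph of its characteristic function is Σ₃,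
and hence so is that of S. Non-membership of `d` means that `(d, 0)` lies on the latter. -/
theorem isSigma3_notMem_of_recursiveInSet {S : Set ℕ} (hS : RecursiveInSet S (jump K)) :
    IsSigma3 fun d => d ∉ S := by
  classical
  have hJ : IsSigma3 fun p : ℕ × ℕ => p.2 ∈ charFun (jump K) p.1 := by
    refine (((isSigma3_mem_jump_K.comp (f := fun p : ℕ × ℕ => p.1) (by fun_prop)).and
      (IsSigma3.of_computable (f := fun p : ℕ × ℕ => p.2 == 1) (by fun_prop))).or
      ((isSigma3_notMem_jump_K.comp (f := fun p : ℕ × ℕ => p.1) (by fun_prop)).and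
      (IsSigma3.of_computable (f := fun p : ℕ × ℕ => p.2 == 0) (by fun_prop)))).congr fun p => ?_
    by_cases hp : p.1 ∈ jump K <;> simp [charFun, hp]
  have hG : IsSigma3 fun p : ℕ × ℕ => p.2 ∈ charFun S p.1 := by
    refine isSigma3_graph (O := {charFun (jump K)}) ?_ (RecursiveIn.iff_nat.1 hS)
    rintro g rfl
    exact hJ
  refine (hG.comp (f := fun d => (d, 0)) (by fun_prop)).congr fun d => ?_
  by_cases hd : d ∈ S <;> simp [charFun, hd]

/-- Only the convergence of the approximation matters: `d ∉ S` iff the bit at `d` is 0 from some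
stage on. -/
theorem isSigma3_notMem_of_isLeftRE {S : Set ℕ} (hS : IsLeftRE S) : IsSigma3 fun d => d ∉ S := by
  obtain ⟨a, ha, -, hlim⟩ := hS
  have ha' : Computable fun p : ℕ × ℕ => a p.1 p.2 := ha
  have h : IsPi2 fun q : ℕ × ℕ => ∀ t, (!a (q.2 + t) q.1) = true := by
    refine IsPi2.all (Q := fun r : (ℕ × ℕ) × ℕ => (!a (r.1.2 + r.2) r.1.1) = true) ?_
    refine IsPi2.of_computable (computable_boolNot ?_)
    exact ha'.comp (f := fun p : ℕ × ℕ => a p.1 p.2) (g := fun r : (ℕ × ℕ) × ℕ =>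
      (r.1.2 + r.2, r.1.1)) (by fun_prop)
  refine (h.isSigma3.ex).congr fun d => ?_
  obtain ⟨s, hs⟩ := eventually_atTop.1 (hlim d)
  constructor
  · intro hd
    exact ⟨s, fun t => by simpa using mt (hs (s + t) (by omega)).1 hd⟩
  · rintro ⟨s', hs'⟩ hd
    have := hs' s
    rw [(hs (s' + s) (by omega)).2 hd] at this
    simp at this

/-! ### A normal form for `Σ₃` predicates -/

/-- The universal `Σ₃` predicate: some section of the domain of `φ_e` is infinite. -/
def UnivSigma3 (e n : ℕ) : Prop :=
  ∃ x, {y | (phi e (Nat.pair n (Nat.pair x y))).Dom}.Infinite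

/-- The program `F n x y` searches for witnesses of the first `y` instances of the Π₂ matrix. Its
domain in `y` is closed downwards, so it is infinite iff every instance has a witness. -/
theorem IsSigma3.exists_univ {Q : ℕ → Prop} (hQ : IsSigma3 Q) : ∃ c, ∀ n, Q n ↔ UnivSigma3 c n := by
  obtain ⟨R, ⟨R', hR', h'⟩, h⟩ := hQ
  let find : ℕ → ℕ → ℕ →. ℕ := fun n x i => Nat.rfind fun z => Part.some (R' ((n, x), i, z))
  let F : ℕ → ℕ → ℕ →. ℕ := fun n x y =>
    Nat.rec (Part.some 0) (fun i ih => ih.bind fun _ => find n x i) y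
  have hF : Partrec fun p : ℕ => F p.unpair.1 p.unpair.2.unpair.1 p.unpair.2.unpair.2 := by
    refine Partrec.nat_rec (h := fun (p : ℕ) (q : ℕ × ℕ) =>
      find p.unpair.1 p.unpair.2.unpair.1 q.1) (by fun_prop) (Partrec.some.comp
        (Computable.const 0)) ?_
    refine Partrec.rfind (p := fun (r : ℕ × ℕ × ℕ) z =>
      Part.some (R' ((r.1.unpair.1, r.1.unpair.2.unpair.1), r.2.1, z))) ?_
    have : Computable fun r : (ℕ × ℕ × ℕ) × ℕ =>
        R' ((r.1.1.unpair.1, r.1.1.unpair.2.unpair.1), r.1.2.1, r.2) := by fun_prop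
    exact this
  have hdom : ∀ n x y, (F n x y).Dom ↔ ∀ i < y, ∃ z, R' ((n, x), i, z) = true := by
    intro n x y
    induction y with
    | zero => simp [F]
    | succ y ih =>
      have h1 : F n x (y + 1) = (F n x y).bind fun _ => find n x y := rfl
      have h2 : (find n x y).Dom ↔ ∃ z, R' ((n, x), y, z) = true := by
        refine Nat.rfind_dom.trans ⟨?_, ?_⟩
        · rintro ⟨z, hz, -⟩
          exact ⟨z, (Part.mem_some_iff.1 hz).symm⟩
        · rintro ⟨z, hz⟩
          exact ⟨z, Part.mem_some_iff.2 hz.symm, fun _ => trivial⟩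
      rw [h1, Part.bind_dom]
      simp only [h2, ih, exists_prop]
      exact Nat.forall_lt_succ_right.symm
  obtain ⟨c, hc⟩ := Code.exists_code.1 (Partrec.nat_iff.1 hF)
  refine ⟨Encodable.encode c, fun n => ?_⟩
  rw [h]
  refine exists_congr fun x => ?_
  have hset : {y | (phi (Encodable.encode c) (Nat.pair n (Nat.pair x y))).Dom} =
      {y | ∀ i < y, ∃ z, R' ((n, x), i, z) = true} := by
    ext y
    simp [phi, hc, hdom]
  rw [hset, h']
  constructor
  · intro H
    rw [Set.eq_univ_of_forall (s := {y | ∀ i < y, ∃ z, R' ((n, x), i, z) = true})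
      fun y i _ => H i]
    exact Set.infinite_univ
  · intro H y
    obtain ⟨y', hy', hlt⟩ := H.exists_gt y
    exact hy' y hlt

/-- The diagonal of the universal `Σ₃` predicate is not `Π₃`. -/
theorem not_isSigma3_not_univSigma3 : ¬ IsSigma3 fun e => ¬ UnivSigma3 e e := by
  intro h
  obtain ⟨c, hc⟩ := h.exists_univ
  exact iff_not_self (hc c).symm

/-! ### Recursively enumerable deficiency sets -/

/-- `n` is a deficiency stage of `v`: some later value is at most `v n`. -/
def Deficient (v : ℕ → ℕ) (n : ℕ) : Prop := ∃ s, n < s ∧ v s ≤ v n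

/-- Let x be the least value taken infinitely often. A stage with value at least x is followed by
another occurrence of x, and only finitely many stages have a smaller value. -/
theorem finite_not_deficient {v : ℕ → ℕ} (h : ∃ x, {s | v s = x}.Infinite) :
    {n | ¬ Deficient v n}.Finite := by
  classical
  have h1 := Nat.find_spec h
  have h2 := fun x (hx : x < Nat.find h) => Set.not_infinite.1 (Nat.find_min h hx)
  refine ((Set.finite_Iio (Nat.find h)).biUnion fun x hx => h2 x hx).subset fun n hn => ?_
  simp only [Set.mem_iUnion, Set.mem_ofPred_eq, exists_prop, exists_eq_right', Set.mem_Iio]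
  by_contra! hlt
  obtain ⟨s, hs, hns⟩ := h1.exists_gt n
  exact hn ⟨s, hns, (show v s = _ from hs) ▸ hlt⟩

/-- The least value attained after `N` is attained a last time, and that stage is not deficient. -/
theorem infinite_not_deficient {v : ℕ → ℕ} (h : ¬ ∃ x, {s | v s = x}.Infinite) :
    {n | ¬ Deficient v n}.Infinite := by
  classical
  push Not at h
  refine Set.infinite_of_forall_exists_gt fun N => ?_
  have hex : ∃ m, ∃ s > N, v s = m := ⟨_, N + 1, by omega, rfl⟩
  obtain ⟨s₀, hs₀, hv₀⟩ := Nat.find_spec hex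
  have hfin : {s | N < s ∧ v s = Nat.find hex}.Finite := (h _).subset fun s hs => hs.2
  obtain ⟨n, ⟨hnN, hnv⟩, hmax⟩ := hfin.exists_maximal ⟨s₀, hs₀, hv₀⟩
  refine ⟨n, ?_, hnN⟩
  rintro ⟨s, hs, hvs⟩
  have hle : Nat.find hex ≤ v s := Nat.find_min' hex ⟨s, by omega, rfl⟩
  have : s ≤ n := hmax ⟨by omega, by omega⟩ hs.le
  omega

/-- Whether the program `e` converges on `⟨e, ⟨x, y⟩⟩` in exactly `z + 1` steps, where `s` codes
`⟨x, ⟨y, z⟩⟩`. -/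
def fires (e s : ℕ) : Bool :=
  (Code.evaln (s.unpair.2.unpair.2 + 1) (Denumerable.ofNat Code e)
    (Nat.pair e (Nat.pair s.unpair.1 s.unpair.2.unpair.1))).isSome &&
  !(Code.evaln s.unpair.2.unpair.2 (Denumerable.ofNat Code e)
    (Nat.pair e (Nat.pair s.unpair.1 s.unpair.2.unpair.1))).isSome

/-- The column that receives attention at stage `s`; by default this is a fresh one. -/
def column (e s : ℕ) : ℕ := bif fires e s then s.unpair.1 else s

@[fun_prop]
theorem computable_column {α : Type*} [Primcodable α] {e s : α → ℕ} (he : Computable e)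
    (hs : Computable s) : Computable fun a => column (e a) (s a) := by
  unfold column fires
  fun_prop

/-- Each `y` in the section fires for exactly one `z`, since `fires` demands convergence at step `z
+ 1` and not before. So column `x` fires once for each such `y`. -/
theorem infinite_column_iff {e x : ℕ} : {s | column e s = x}.Infinite ↔
    {y | (phi e (Nat.pair e (Nat.pair x y))).Dom}.Infinite := by
  constructor
  · intro h
    -- By default only the stage `s = x` is given to column `x`; every other stage in the column
    -- fires.
    have h' : ({s | column e s = x} \ {x}).Infinite := h.sdiff (Set.finite_singleton x)
    have hfire : ∀ s ∈ {s | column e s = x} \ {x}, fires e s = true ∧ s.unpair.1 = x := by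
      rintro s ⟨hs, hsx⟩
      cases hf : fires e s
      · simp only [column, hf, cond_false, Set.mem_ofPred_eq] at hs
        exact (hsx hs).elim
      · simp only [column, hf, cond_true, Set.mem_ofPred_eq] at hs
        exact ⟨rfl, hs⟩
    refine (h'.image (f := fun s => s.unpair.2.unpair.1) ?_).mono ?_
    · intro s hs s' hs' heq
      obtain ⟨hf, hx⟩ := hfire s hs
      obtain ⟨hf', hx'⟩ := hfire s' hs'
      simp only at heq
      simp only [fires, hx, hx', heq, Bool.and_eq_true, Bool.not_eq_true'] at hf hf'
      have hz : s.unpair.2.unpair.2 = s'.unpair.2.unpair.2 := by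
        refine le_antisymm ?_ ?_ <;> by_contra! hlt
        · have := isSome_evaln_mono (Nat.succ_le_of_lt hlt) hf'.1
          rw [hf.2] at this
          exact Bool.false_ne_true this
        · have := isSome_evaln_mono (Nat.succ_le_of_lt hlt) hf.1
          rw [hf'.2] at this
          exact Bool.false_ne_true this
      rw [← Nat.pair_unpair s, ← Nat.pair_unpair s', hx, hx', ← Nat.pair_unpair s.unpair.2,
        ← Nat.pair_unpair s'.unpair.2, heq, hz]
    · rintro _ ⟨s, hs, rfl⟩
      obtain ⟨hf, hx⟩ := hfire s hs
      simp only [fires, hx, Bool.and_eq_true] at hf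
      exact phi_dom_iff.2 ⟨_, hf.1⟩
  · intro h
    have hz : ∀ y ∈ {y | (phi e (Nat.pair e (Nat.pair x y))).Dom}, ∃ z,
        fires e (Nat.pair x (Nat.pair y z)) = true := by
      classical
      intro y hy
      have hy' := phi_dom_iff.1 hy
      have h1 := Nat.find_spec hy'
      cases hn : Nat.find hy' with
      -- With step bound 0 nothing converges, so the least sufficient bound is a successor.
      | zero => simp [hn, Code.evaln] at h1
      | succ z =>
        refine ⟨z, ?_⟩
        have h2 := Nat.find_min hy' (m := z) (by omega)
        rw [hn] at h1
        simpa [fires] using ⟨h1, by simpa using h2⟩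
    choose! z hz using hz
    refine (h.image (f := fun y => Nat.pair x (Nat.pair y (z y))) ?_).mono ?_
    · intro y _ y' _ heq
      simpa using congrArg (fun s => s.unpair.2.unpair.1) heq
    · rintro _ ⟨y, hy, rfl⟩
      simp [column, hz y hy]

/-- The stage `s` approximation of the set of deficiency stages of `column e`. -/
def deficientApprox (e s n : ℕ) : Bool :=
  anyBelow s fun i => Nat.ble (n + 1) i && Nat.ble (column e i) (column e n)

theorem computable_deficientApprox :
    Computable fun q : ℕ × ℕ × ℕ => deficientApprox q.1 q.2.1 q.2.2 :=
  computable_anyBelow (p := fun (q : ℕ × ℕ × ℕ) i =>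
    Nat.ble (q.2.2 + 1) i && Nat.ble (column q.1 i) (column q.1 q.2.2)) (by fun_prop)
    (by fun_prop)

theorem deficientApprox_eq_true {e s n : ℕ} : deficientApprox e s n = true ↔
    ∃ i < s, n < i ∧ column e i ≤ column e n := by
  simp [deficientApprox, anyBelow_eq_true]

theorem deficientApprox_mono {e s s' n : ℕ} (h : s ≤ s') (hs : deficientApprox e s n = true) :
    deficientApprox e s' n = true := by
  rw [deficientApprox_eq_true] at hs ⊢
  obtain ⟨i, hi, h'⟩ := hs
  exact ⟨i, by omega, h'⟩

theorem eventually_deficientApprox (e n : ℕ) :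
    ∀ᶠ s in atTop, (deficientApprox e s n = true ↔ Deficient (column e) n) := by
  by_cases h : Deficient (column e) n
  · obtain ⟨i, hi⟩ := h
    filter_upwards [eventually_gt_atTop i] with s hs
    rw [deficientApprox_eq_true]
    exact ⟨fun ⟨j, _, hj⟩ => ⟨j, hj⟩, fun _ => ⟨i, hs, hi⟩⟩
  · refine Eventually.of_forall fun s => ?_
    rw [deficientApprox_eq_true]
    exact ⟨fun ⟨j, _, hj⟩ => ⟨j, hj⟩, fun h' => (h h').elim⟩

/-! ### The lexicographic order and binary values of initial segments -/

theorem lexLE_of_first_diff {A B : Set ℕ} {x : ℕ} (h : ∀ y < x, (y ∈ A ↔ y ∈ B)) (hA : x ∉ A)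
    (hB : x ∈ B) : LexLE A B := by
  refine .inr ⟨x, ⟨.inr ⟨hB, hA⟩, fun y hy => ?_⟩, hB⟩
  by_contra! hlt
  rcases hy with hy | hy
  · exact hy.2 ((h y hlt).1 hy.1)
  · exact hy.2 ((h y hlt).2 hy.1)

theorem LexLE.exists_first_diff {A B : Set ℕ} (h : LexLE A B) :
    A = B ∨ ∃ x, (∀ y < x, (y ∈ A ↔ y ∈ B)) ∧ x ∉ A ∧ x ∈ B := by
  refine h.imp id ?_
  rintro ⟨x, ⟨hx, hmin⟩, hB⟩
  refine ⟨x, fun y hy => ?_, fun hA => ?_, hB⟩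
  · by_contra hne
    have : y ∈ symmDiff A B := by
      rw [Set.mem_symmDiff]
      tauto
    exact (hmin this).not_gt hy
  · rcases hx with hx | hx
    exacts [hx.2 hB, hx.2 hA]

/-- The number whose binary digits are `f 0, ..., f (b - 1)`, the most significant one first. -/
def prefixVal (f : ℕ → Bool) (b : ℕ) : ℕ := Nat.rec 0 (fun i v => 2 * v + (f i).toNat) b

theorem prefixVal_zero (f : ℕ → Bool) : prefixVal f 0 = 0 := rfl

theorem prefixVal_succ (f : ℕ → Bool) (b : ℕ) :
    prefixVal f (b + 1) = 2 * prefixVal f b + (f b).toNat := rfl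

theorem computable_prefixVal {α : Type*} [Primcodable α] {f : α → ℕ → Bool} {b : α → ℕ}
    (hf : Computable fun p : α × ℕ => f p.1 p.2) (hb : Computable b) :
    Computable fun a => prefixVal (f a) (b a) := by
  refine computable_natRec (h := fun a i v => 2 * v + (f a i).toNat) hb (by fun_prop) ?_
  have h1 : Computable fun q : α × ℕ × ℕ => f q.1 q.2.1 :=
    hf.comp (f := fun p : α × ℕ => f p.1 p.2) (g := fun q : α × ℕ × ℕ => (q.1, q.2.1))
      (by fun_prop)
  have h2 : Computable fun q : α × ℕ × ℕ => (f q.1 q.2.1).toNat :=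
    (Primrec.dom_bool Bool.toNat).to_comp.comp h1
  fun_prop

theorem prefixVal_lt (f : ℕ → Bool) (b : ℕ) : prefixVal f b < 2 ^ b := by
  induction b with
  | zero => simp [prefixVal_zero]
  | succ b ih =>
    have := Bool.toNat_le (f b)
    rw [prefixVal_succ, pow_succ]
    omega

theorem prefixVal_congr {f g : ℕ → Bool} {b : ℕ} (h : ∀ i < b, f i = g i) :
    prefixVal f b = prefixVal g b := by
  induction b with
  | zero => rfl
  | succ b ih => rw [prefixVal_succ, prefixVal_succ, ih fun i hi => h i (by omega), h b (by omega)]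

theorem prefixVal_not (f : ℕ → Bool) (b : ℕ) :
    prefixVal (fun i => !f i) b + prefixVal f b + 1 = 2 ^ b := by
  induction b with
  | zero => simp [prefixVal_zero]
  | succ b ih =>
    rw [prefixVal_succ, prefixVal_succ, pow_succ]
    cases f b <;> simp <;> omega

/-- After the first difference the value for `g` is ahead by one, and appending digits by `2 * v +
bit` preserves strict inequality. -/
theorem prefixVal_le_of_lexLE {f g : ℕ → Bool} (h : LexLE {n | f n = true} {n | g n = true})
    (b : ℕ) : prefixVal f b ≤ prefixVal g b := by
  rcases h.exists_first_diff with h | ⟨x, hlt, hA, hB⟩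
  · exact (prefixVal_congr fun i _ => by
      rw [Bool.eq_iff_iff]
      exact Set.ext_iff.1 h i).le
  · have hlt' : ∀ y < x, f y = g y := fun y hy => by
      rw [Bool.eq_iff_iff]
      exact hlt y hy
    rcases le_or_gt b x with hbx | hbx
    · exact (prefixVal_congr fun i hi => hlt' i (by omega)).le
    · refine Nat.le_of_lt ?_
      induction b, hbx using Nat.le_induction with
      | base =>
        have hA' : f x = false := by simpa using hA
        have hB' : g x = true := hB
        rw [prefixVal_succ, prefixVal_succ, prefixVal_congr hlt', hA', hB']
        simp
      | succ b _ ih =>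
        have := Bool.toNat_le (f b)
        rw [prefixVal_succ, prefixVal_succ]
        omega

theorem prefixVal_add_of_false {f : ℕ → Bool} {b : ℕ} :
    ∀ {d : ℕ}, (∀ i < d, f (b + i) = false) → prefixVal f (b + d) = prefixVal f b * 2 ^ d
  | 0, _ => by simp
  | d + 1, h => by
    rw [← add_assoc, prefixVal_succ, prefixVal_add_of_false fun i hi => h i (by omega),
      h d (by omega), pow_succ]
    simp only [Bool.toNat_false]
    ring

/-- The value of a prefix that contains exactly one element past `b`, with `d` digits after it. -/
theorem prefixVal_of_single {f : ℕ → Bool} {b q d : ℕ} (hbq : b ≤ q)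
    (h : ∀ i, b ≤ i → i < q + 1 + d → (f i = true ↔ i = q)) :
    prefixVal f (q + 1 + d) = prefixVal f b * 2 ^ (q + 1 + d - b) + 2 ^ d := by
  obtain ⟨k, rfl⟩ := Nat.exists_eq_add_of_le hbq
  have h1 : prefixVal f (b + k) = prefixVal f b * 2 ^ k := by
    refine prefixVal_add_of_false fun i hi => ?_
    have := h (b + i) (by omega) (by omega)
    rw [Bool.eq_false_iff]
    intro h'
    have := this.1 h'
    omega
  have h2 : f (b + k) = true := (h _ hbq (by omega)).2 rfl
  have h3 : prefixVal f (b + k + 1 + d) = prefixVal f (b + k + 1) * 2 ^ d := by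
    refine prefixVal_add_of_false fun i hi => ?_
    have := h (b + k + 1 + i) (by omega) (by omega)
    rw [Bool.eq_false_iff]
    intro h'
    have := this.1 h'
    omega
  rw [h3, prefixVal_succ, h1, h2, show b + k + 1 + d - b = k + 1 + d by omega]
  simp only [Bool.toNat_true]
  ring

/-! ### Blocks -/

/-- A strict bound for the number of moves of the `n`-th marker, if its block starts at `b`. -/
def room (n b : ℕ) : ℕ := (n + 1) * 2 ^ b + 1

/-- The number of places for the `n`-th marker, if its block starts at `b`. -/
def places (n b : ℕ) : ℕ := (n * room n b + 1) * room n b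

/-- The `n`-th block is the interval from `base n` to `base (n + 1)`. -/
def base (n : ℕ) : ℕ := Nat.rec 0 (fun n b => b + 3 * places n b) n

/-- The number of places for the `n`-th marker. -/
def width (n : ℕ) : ℕ := places n (base n)

theorem base_succ (n : ℕ) : base (n + 1) = base n + 3 * width n := rfl

theorem width_pos (n : ℕ) : 0 < width n := by
  unfold width places room
  positivity

theorem base_strictMono : StrictMono base :=
  strictMono_nat_of_lt_succ fun n => by
    have := width_pos n
    rw [base_succ]
    omega

/-- The index of the block that contains `m`. -/
def blockOf (m : ℕ) : ℕ :=
  Nat.rec 0 (fun m n => bif Nat.ble (base (n + 1)) (m + 1) then n + 1 else n) m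

theorem base_blockOf (m : ℕ) : base (blockOf m) ≤ m ∧ m < base (blockOf m + 1) := by
  induction m with
  | zero => exact ⟨le_rfl, base_strictMono (Nat.zero_lt_one)⟩
  | succ m ih =>
    have h : blockOf (m + 1) =
      bif Nat.ble (base (blockOf m + 1)) (m + 1) then blockOf m + 1 else blockOf m := rfl
    cases hb : Nat.ble (base (blockOf m + 1)) (m + 1)
    · rw [h, hb]
      have : ¬ base (blockOf m + 1) ≤ m + 1 := by
        rw [← Nat.ble_eq, hb]
        exact Bool.false_ne_true
      exact ⟨by simp only [cond_false]; omega, by simp only [cond_false]; omega⟩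
    · rw [h, hb]
      rw [Nat.ble_eq] at hb
      have := base_strictMono (Nat.lt_add_one (blockOf m + 1))
      exact ⟨by simpa using hb, by simp only [cond_true]; omega⟩

theorem blockOf_eq {n m : ℕ} (h : base n ≤ m) (h' : m < base (n + 1)) : blockOf m = n := by
  obtain ⟨h1, h2⟩ := base_blockOf m
  have h3 := base_strictMono.lt_iff_lt.1 (h1.trans_lt h')
  have h4 := base_strictMono.lt_iff_lt.1 (h.trans_lt h2)
  omega

theorem blockOf_add {n i : ℕ} (h : i < 3 * width n) : blockOf (base n + i) = n :=
  blockOf_eq (by omega) (by rw [base_succ]; omega)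

theorem le_base (n : ℕ) : n ≤ base n := base_strictMono.le_apply

section

variable {α : Type*} [Primcodable α]

@[fun_prop]
theorem computable_room {f g : α → ℕ} (hf : Computable f) (hg : Computable g) :
    Computable fun a => room (f a) (g a) := by
  unfold room
  fun_prop

@[fun_prop]
theorem computable_places {f g : α → ℕ} (hf : Computable f) (hg : Computable g) :
    Computable fun a => places (f a) (g a) := by
  unfold places
  fun_prop

@[fun_prop]
theorem computable_base {f : α → ℕ} (hf : Computable f) : Computable fun a => base (f a) :=
  computable_natRec (h := fun _ n b => b + 3 * places n b) hf (by fun_prop) (by fun_prop)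

@[fun_prop]
theorem computable_width {f : α → ℕ} (hf : Computable f) : Computable fun a => width (f a) := by
  unfold width
  fun_prop

@[fun_prop]
theorem computable_blockOf {f : α → ℕ} (hf : Computable f) : Computable fun a => blockOf (f a) :=
  computable_natRec (h := fun _ m n => bif Nat.ble (base (n + 1)) (m + 1) then n + 1 else n) hf
    (by fun_prop) (by fun_prop)

end

/-- The position within the block of the place with index `j`: blocks are reversed if `ν`. -/
def mirror (ν : Bool) (n j : ℕ) : ℕ := bif ν then 3 * width n - 1 - j else j

theorem mirror_lt {ν : Bool} {n j : ℕ} (h : j < 3 * width n) : mirror ν n j < 3 * width n := by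
  cases ν
  · exact h
  · simp only [mirror, cond_true]
    omega

theorem mirror_mirror {ν : Bool} {n j : ℕ} (h : j < 3 * width n) :
    mirror ν n (mirror ν n j) = j := by
  cases ν
  · rfl
  · simp only [mirror, cond_true]
    omega

/-- The contents of a block whose marker is at place `p`: one element if `w`, otherwise two of
them or, if `k` is false, only the first of the two. -/
def contents (k w : Bool) (p j : ℕ) : Bool :=
  bif w then j == 3 * p else (j == 3 * p + 1 || (k && j == 3 * p + 2))

/-- The witness is the first element of the new contents; the old contents begin strictly later. In
the next lemma, for reversed blocks, it is the last element of the old contents. -/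
theorem exists_first_contents {k w w' : Bool} {p p' W : ℕ} (hlt : p < W)
    (h : p' < p ∨ (p' = p ∧ w = false ∧ w' = true)) :
    ∃ x < 3 * W, (∀ j ≤ x, contents k w p j = false) ∧
      (∀ j < x, contents k w' p' j = false) ∧ contents k w' p' x = true := by
  refine ⟨bif w' then 3 * p' else 3 * p' + 1, ?_, ?_, ?_, ?_⟩ <;>
  cases w <;> cases w' <;> cases k <;> simp [contents] at h ⊢ <;> omega

theorem exists_last_contents {k w w' : Bool} {p p' W : ℕ} (hlt : p < W)
    (h : p' < p ∨ (p' = p ∧ w = false ∧ w' = true)) :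
    ∃ x < 3 * W, (∀ j ≥ x, contents k w' p' j = false) ∧
      (∀ j > x, contents k w p j = false) ∧ contents k w p x = true := by
  refine ⟨bif w then 3 * p else (bif k then 3 * p + 2 else 3 * p + 1), ?_, ?_, ?_, ?_⟩ <;>
  cases w <;> cases w' <;> cases k <;> simp [contents] at h ⊢ <;> omega

/-- The set with the given block contents, complemented and with reversed blocks if `ν`. -/
def blockSet (ν k : Bool) (w : ℕ → Bool) (p : ℕ → ℕ) (m : ℕ) : Bool :=
  xor (contents k (w (blockOf m)) (p (blockOf m))
    (mirror ν (blockOf m) (m - base (blockOf m)))) ν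

theorem blockSet_add {ν k : Bool} {w : ℕ → Bool} {p : ℕ → ℕ} {n i : ℕ} (h : i < 3 * width n) :
    blockSet ν k w p (base n + i) = xor (contents k (w n) (p n) (mirror ν n i)) ν := by
  rw [blockSet, blockOf_add h, Nat.add_sub_cancel_left]

theorem computable_blockSet {α : Type*} [Primcodable α] {ν k : Bool} {w : α → ℕ → Bool}
    {p : α → ℕ → ℕ} {m : α → ℕ} (hw : Computable fun q : α × ℕ => w q.1 q.2)
    (hp : Computable fun q : α × ℕ => p q.1 q.2) (hm : Computable m) :
    Computable fun a => blockSet ν k (w a) (p a) (m a) := by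
  have hw' : Computable fun a => w a (blockOf (m a)) :=
    hw.comp (f := fun q : α × ℕ => w q.1 q.2) (g := fun a => (a, blockOf (m a))) (by fun_prop)
  have hp' : Computable fun a => p a (blockOf (m a)) :=
    hp.comp (f := fun q : α × ℕ => p q.1 q.2) (g := fun a => (a, blockOf (m a))) (by fun_prop)
  unfold blockSet contents mirror
  fun_prop

/-- The first block that changes decides the comparison. Therefore `hp` demands descent of a marker
only while all earlier ones stay put, which leaves later markers free to be reset upwards. -/
theorem lexLE_blockSet {ν k : Bool} {w w' : ℕ → Bool} {p p' : ℕ → ℕ}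
    (hw : ∀ n, w n = true → w' n = true) (hlt : ∀ n, p n < width n)
    (hp : ∀ n, (∀ m < n, p m = p' m) → p' n ≤ p n) :
    LexLE {m | blockSet ν k w p m = true} {m | blockSet ν k w' p' m = true} := by
  classical
  by_cases hne : ∃ n, ¬ (p n = p' n ∧ w n = w' n)
  swap
  · push Not at hne
    have h1 : p = p' := funext fun n => (hne n).1
    have h2 : w = w' := funext fun n => (hne n).2
    exact .inl (by rw [h1, h2])
  obtain ⟨n, hn, hmin⟩ : ∃ n, ¬ (p n = p' n ∧ w n = w' n) ∧
      ∀ m < n, p m = p' m ∧ w m = w' m :=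
    ⟨Nat.find hne, Nat.find_spec hne, fun m hm => not_not.1 (Nat.find_min hne hm)⟩
  have hpn := hp n fun m hm => (hmin m hm).1
  have hltn := hlt n
  have hcase : p' n < p n ∨ (p' n = p n ∧ w n = false ∧ w' n = true) := by
    rcases hpn.lt_or_eq with h | h
    · exact .inl h
    · refine .inr ⟨h, ?_⟩
      have h1 : w n ≠ w' n := fun h2 => hn ⟨h.symm, h2⟩
      have h2 := hw n
      revert h1 h2
      cases w n <;> cases w' n <;> simp
  have hbefore : ∀ y < base n, (y ∈ {m | blockSet ν k w p m = true} ↔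
      y ∈ {m | blockSet ν k w' p' m = true}) := by
    intro y hy
    have hb : blockOf y < n :=
      base_strictMono.lt_iff_lt.1 ((base_blockOf y).1.trans_lt hy)
    simp only [Set.mem_ofPred_eq, blockSet, hmin _ hb]
  cases ν
  · obtain ⟨x, hxlt, hx, hx', hxw⟩ := exists_first_contents (k := k) hltn hcase
    refine lexLE_of_first_diff (x := base n + x) (fun y hy => ?_) ?_ ?_
    · rcases lt_or_ge y (base n) with h | h
      · exact hbefore y h
      · obtain ⟨i, rfl⟩ := Nat.exists_eq_add_of_le h
        have hi : i < x := by omega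
        simp only [Set.mem_ofPred_eq]
        rw [blockSet_add (by omega), blockSet_add (by omega)]
        simp only [mirror, cond_false]
        rw [hx i hi.le, hx' i hi]
    · simp only [Set.mem_ofPred_eq]
      rw [blockSet_add (by omega)]
      simp [mirror, hx x le_rfl]
    · simp only [Set.mem_ofPred_eq]
      rw [blockSet_add (by omega)]
      simp [mirror, hxw]
  · obtain ⟨x, hxlt, hx, hx', hxw⟩ := exists_last_contents (k := k) hltn hcase
    refine lexLE_of_first_diff (x := base n + (3 * width n - 1 - x)) (fun y hy => ?_) ?_ ?_
    · rcases lt_or_ge y (base n) with h | h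
      · exact hbefore y h
      · obtain ⟨i, rfl⟩ := Nat.exists_eq_add_of_le h
        simp only [Set.mem_ofPred_eq]
        rw [blockSet_add (by omega), blockSet_add (by omega)]
        simp only [mirror, cond_true]
        rw [hx _ (by omega), hx' _ (by omega)]
    · simp only [Set.mem_ofPred_eq]
      rw [blockSet_add (by omega)]
      simp only [mirror, cond_true]
      rw [show 3 * width n - 1 - (3 * width n - 1 - x) = x by omega, hxw]
      simp
    · simp only [Set.mem_ofPred_eq]
      rw [blockSet_add (by omega)]
      simp only [mirror, cond_true]
      rw [show 3 * width n - 1 - (3 * width n - 1 - x) = x by omega, hx x le_rfl]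
      simp

theorem eventually_blockSet {ν k : Bool} {w : ℕ → ℕ → Bool} {w' : ℕ → Bool} {p : ℕ → ℕ → ℕ}
    {p' : ℕ → ℕ} (hw : ∀ n, ∀ᶠ s in atTop, w s n = w' n) (hp : ∀ n, ∀ᶠ s in atTop, p s n = p' n)
    (m : ℕ) : ∀ᶠ s in atTop, blockSet ν k (w s) (p s) m = blockSet ν k w' p' m := by
  filter_upwards [hw (blockOf m), hp (blockOf m)] with s h1 h2
  rw [blockSet, blockSet, h1, h2]

/-! ### The movement of the markers -/

/-- The number of events in `L` that move the marker `n`. -/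
def moves (n : ℕ) (L : List (ℕ × ℕ × ℕ)) : ℕ := (L.filter fun ev => ev.1 = n).length

/-- The number of events in `L` that reset the marker `n`. -/
def resets (n : ℕ) (L : List (ℕ × ℕ × ℕ)) : ℕ := (L.filter fun ev => ev.1 < n).length

/-- The place of the marker `n` after the events in `L`. -/
def mark (n : ℕ) (L : List (ℕ × ℕ × ℕ)) : ℕ :=
  resets n L * room n (base n) + (room n (base n) - 1 - moves n L)

@[fun_prop]
theorem computable_mark {α : Type*} [Primcodable α] {n : α → ℕ} {L : α → List (ℕ × ℕ × ℕ)}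
    (hn : Computable n) (hL : Computable L) : Computable fun a => mark (n a) (L a) := by
  have h1 : Computable fun a => moves (n a) (L a) :=
    (Primrec.list_length.comp (PrimrecRel.listFilter (R := fun (ev : ℕ × ℕ × ℕ) n => ev.1 = n)
      (Primrec.eq.comp (Primrec.fst.comp Primrec.fst) Primrec.snd))).to_comp.comp (hL.pair hn)
  have h2 : Computable fun a => resets (n a) (L a) :=
    (Primrec.list_length.comp (PrimrecRel.listFilter (R := fun (ev : ℕ × ℕ × ℕ) n => ev.1 < n)
      (Primrec.nat_lt.comp (Primrec.fst.comp Primrec.fst) Primrec.snd))).to_comp.comp (hL.pair hn)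
  unfold mark
  fun_prop

/-- The number of digits after the place `p` in block `n`. -/
def digitsAfter (ν : Bool) (n p : ℕ) : ℕ := bif ν then 3 * p else 3 * width n - 1 - 3 * p

variable (a : ℕ → ℕ → ℕ → Bool) (ν : Bool)

/-- The event that may be caused by stage `s`. -/
def candidate (s : ℕ) : ℕ × ℕ × ℕ :=
  (s.unpair.1.unpair.1, s.unpair.1.unpair.2,
    prefixVal (fun i => xor (a s.unpair.1.unpair.2 s i) ν) (base s.unpair.1.unpair.1))

/-- Whether the candidate event of stage `s` happens: the set with index `e` is disjoint from
block `n`, and meets block `n + 1` exactly in the marker. -/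
def happens (s : ℕ) (L : List (ℕ × ℕ × ℕ)) : Bool :=
  Nat.ble s.unpair.1.unpair.2 s.unpair.1.unpair.1 &&
  (prefixVal (fun i => xor (a s.unpair.1.unpair.2 s i) ν) (base (s.unpair.1.unpair.1 + 2)) ==
    (candidate a ν s).2.2 *
      2 ^ (base (s.unpair.1.unpair.1 + 2) - base s.unpair.1.unpair.1) +
    2 ^ digitsAfter ν (s.unpair.1.unpair.1 + 1) (mark (s.unpair.1.unpair.1 + 1) L)) &&
  !decide (candidate a ν s ∈ L)

/-- The events up to stage `s`. -/
def events (s : ℕ) : List (ℕ × ℕ × ℕ) :=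
  Nat.rec [] (fun s L => bif happens a ν s L then candidate a ν s :: L else L) s

variable {a ν}

theorem computable_events (ha : Computable fun p : ℕ × ℕ × ℕ => a p.1 p.2.1 p.2.2)
    {α : Type*} [Primcodable α] {f : α → ℕ} (hf : Computable f) :
    Computable fun x => events a ν (f x) := by
  have h1 : Computable fun q : (ℕ × ℕ) × ℕ =>
      prefixVal (fun i => xor (a q.1.1 q.1.2 i) ν) q.2 := by
    refine computable_prefixVal (f := fun (q : (ℕ × ℕ) × ℕ) i => xor (a q.1.1 q.1.2 i) ν) ?_
      (by fun_prop)
    have : Computable fun r : ((ℕ × ℕ) × ℕ) × ℕ => a r.1.1.1 r.1.1.2 r.2 :=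
      ha.comp (f := fun p : ℕ × ℕ × ℕ => a p.1 p.2.1 p.2.2)
        (g := fun r : ((ℕ × ℕ) × ℕ) × ℕ => (r.1.1.1, r.1.1.2, r.2)) (by fun_prop)
    fun_prop
  have h2 : ∀ {g : ℕ → ℕ}, Computable g → Computable fun s : ℕ =>
      prefixVal (fun i => xor (a s.unpair.1.unpair.2 s i) ν) (g s) := fun {g} hg =>
    h1.comp (f := fun q : (ℕ × ℕ) × ℕ => prefixVal (fun i => xor (a q.1.1 q.1.2 i) ν) q.2)
      (g := fun s : ℕ => ((s.unpair.1.unpair.2, s), g s)) (by fun_prop)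
  have h3 : Computable (candidate a ν) := by
    have := h2 (g := fun s => base s.unpair.1.unpair.1) (by fun_prop)
    unfold candidate
    fun_prop
  have h4 : Computable fun q : List (ℕ × ℕ × ℕ) × (ℕ × ℕ × ℕ) => decide (q.2 ∈ q.1) := by
    have : PrimrecRel fun (L : List (ℕ × ℕ × ℕ)) (ev : ℕ × ℕ × ℕ) => ev ∈ L :=
      (PrimrecRel.exists_mem_list (R := fun ev ev' : ℕ × ℕ × ℕ => ev = ev') Primrec.eq).of_eq
        fun L ev => by simp
    exact this.decide.to_comp
  have h5 : Computable fun q : ℕ × List (ℕ × ℕ × ℕ) => decide (candidate a ν q.1 ∈ q.2) :=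
    h4.comp (f := fun q : List (ℕ × ℕ × ℕ) × (ℕ × ℕ × ℕ) => decide (q.2 ∈ q.1))
      (g := fun q : ℕ × List (ℕ × ℕ × ℕ) => (q.2, candidate a ν q.1)) (by fun_prop)
  have h6 : Computable fun q : ℕ × List (ℕ × ℕ × ℕ) => happens a ν q.1 q.2 := by
    have h7 : Computable fun q : ℕ × List (ℕ × ℕ × ℕ) =>
        prefixVal (fun i => xor (a q.1.unpair.1.unpair.2 q.1 i) ν)
          (base (q.1.unpair.1.unpair.1 + 2)) :=
      (h2 (g := fun s => base (s.unpair.1.unpair.1 + 2)) (by fun_prop)).comp Computable.fst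
    have h9 : Computable fun q : ℕ × List (ℕ × ℕ × ℕ) => (candidate a ν q.1).2.2 :=
      computable_snd' (computable_snd' (h3.comp Computable.fst))
    have h10 : Computable fun q : ℕ × List (ℕ × ℕ × ℕ) => digitsAfter ν
        (q.1.unpair.1.unpair.1 + 1) (mark (q.1.unpair.1.unpair.1 + 1) q.2) := by
      cases ν <;> simp only [digitsAfter, cond_true, cond_false] <;> fun_prop
    refine computable_boolAnd (computable_boolAnd (by fun_prop) (computable_beq h7 ?_))
      (computable_boolNot h5)
    exact computable_natAdd (computable_natMul h9 (by fun_prop)) (computable_natPow (by fun_prop) h10)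
  have h8 : Computable fun p : α × ℕ × List (ℕ × ℕ × ℕ) => happens a ν p.2.1 p.2.2 :=
    h6.comp Computable.snd
  exact computable_natRec (h := fun _ s L => bif happens a ν s L then candidate a ν s :: L else L)
    hf (by fun_prop) (by fun_prop)

theorem events_succ (s : ℕ) : events a ν (s + 1) =
    bif happens a ν s (events a ν s) then candidate a ν s :: events a ν s else events a ν s := rfl

theorem events_succ_cases (s : ℕ) : events a ν (s + 1) = events a ν s ∨
    (happens a ν s (events a ν s) = true ∧
      events a ν (s + 1) = candidate a ν s :: events a ν s) := by
  rw [events_succ]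
  cases happens a ν s (events a ν s) <;> simp

theorem happens_iff {s : ℕ} {L : List (ℕ × ℕ × ℕ)} : happens a ν s L = true ↔
    s.unpair.1.unpair.2 ≤ s.unpair.1.unpair.1 ∧
    prefixVal (fun i => xor (a s.unpair.1.unpair.2 s i) ν) (base (s.unpair.1.unpair.1 + 2)) =
      (candidate a ν s).2.2 *
        2 ^ (base (s.unpair.1.unpair.1 + 2) - base s.unpair.1.unpair.1) +
      2 ^ digitsAfter ν (s.unpair.1.unpair.1 + 1) (mark (s.unpair.1.unpair.1 + 1) L) ∧
    candidate a ν s ∉ L := by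
  simp [happens, and_assoc]

theorem events_nodup (s : ℕ) : (events a ν s).Nodup := by
  induction s with
  | zero => exact List.nodup_nil
  | succ s ih =>
    rcases events_succ_cases (a := a) (ν := ν) s with h | ⟨h, h'⟩
    · rwa [h]
    · rw [h']
      exact List.nodup_cons.2 ⟨(happens_iff.1 h).2.2, ih⟩

theorem events_bound {s : ℕ} {ev : ℕ × ℕ × ℕ} (h : ev ∈ events a ν s) :
    ev.2.1 ≤ ev.1 ∧ ev.2.2 < 2 ^ base ev.1 := by
  induction s with
  | zero => simp [events] at h
  | succ s ih =>
    rcases events_succ_cases (a := a) (ν := ν) s with h' | ⟨h1, h'⟩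
    · exact ih (h' ▸ h)
    · rw [h', List.mem_cons] at h
      rcases h with rfl | h
      · exact ⟨(happens_iff.1 h1).1, prefixVal_lt _ _⟩
      · exact ih h

theorem suffix_events {s t : ℕ} (h : s ≤ t) : events a ν s <:+ events a ν t := by
  induction t, h using Nat.le_induction with
  | base => exact List.suffix_rfl
  | succ t _ ih =>
    rcases events_succ_cases (a := a) (ν := ν) t with h' | ⟨-, h'⟩
    · rwa [h']
    · rw [h']
      exact ih.trans (List.suffix_cons _ _)

theorem moves_mono {n s t : ℕ} (h : s ≤ t) :
    moves n (events a ν s) ≤ moves n (events a ν t) :=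
  ((suffix_events h).sublist.filter _).length_le

theorem resets_mono {n s t : ℕ} (h : s ≤ t) :
    resets n (events a ν s) ≤ resets n (events a ν t) :=
  ((suffix_events h).sublist.filter _).length_le

/-- Events never repeat, and one that moves marker `n` is determined by an index at most `n` and a
prefix value below `2 ^ base n`. -/
theorem moves_le (n s : ℕ) : moves n (events a ν s) ≤ (n + 1) * 2 ^ base n := by
  have hnd := (events_nodup (a := a) (ν := ν) s).filter fun ev => ev.1 = n
  rw [moves, ← List.toFinset_card_of_nodup hnd]
  have hsub : ((events a ν s).filter fun ev => ev.1 = n).toFinset ⊆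
      {n} ×ˢ (Finset.range (n + 1) ×ˢ Finset.range (2 ^ base n)) := by
    intro ev hev
    simp only [List.mem_toFinset, List.mem_filter, decide_eq_true_eq] at hev
    have := events_bound hev.1
    rw [hev.2] at this
    simp only [Finset.mem_product, Finset.mem_singleton, Finset.mem_range]
    exact ⟨hev.2, by omega, this.2⟩
  simpa using Finset.card_le_card hsub

theorem resets_le (n s : ℕ) : resets n (events a ν s) ≤ n * room n (base n) := by
  have hnd := (events_nodup (a := a) (ν := ν) s).filter fun ev => ev.1 < n
  rw [resets, ← List.toFinset_card_of_nodup hnd]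
  have hsub : ((events a ν s).filter fun ev => ev.1 < n).toFinset ⊆
      Finset.range n ×ˢ (Finset.range (n + 1) ×ˢ Finset.range (2 ^ base n)) := by
    intro ev hev
    simp only [List.mem_toFinset, List.mem_filter, decide_eq_true_eq] at hev
    have h1 := events_bound hev.1
    have h2 : 2 ^ base ev.1 ≤ 2 ^ base n :=
      Nat.pow_le_pow_right (by omega) (base_strictMono.monotone hev.2.le)
    simp only [Finset.mem_product, Finset.mem_range]
    exact ⟨hev.2, by omega, by omega⟩
  refine (Finset.card_le_card hsub).trans ?_
  simp only [Finset.card_product, Finset.card_range]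
  exact Nat.mul_le_mul_left _ (Nat.le_succ _)

theorem mark_lt (n s : ℕ) : mark n (events a ν s) < width n := by
  have h1 := Nat.mul_le_mul_right (room n (base n)) (resets_le (a := a) (ν := ν) n s)
  have h2 : 0 < room n (base n) := Nat.succ_pos _
  rw [width, places, add_mul, one_mul, mark]
  omega

/-- A reset raises the marker by `room`, which is more than all its moves together can take away. -/
theorem mark_lt_mark {n s t : ℕ} (h : resets n (events a ν s) < resets n (events a ν t)) :
    mark n (events a ν s) < mark n (events a ν t) := by
  have h1 := Nat.mul_le_mul_right (room n (base n)) (Nat.succ_le_of_lt h)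
  have h2 : 0 < room n (base n) := Nat.succ_pos _
  rw [Nat.succ_mul] at h1
  rw [mark, mark]
  omega

/-- An event that resets marker `n` strictly lowers an earlier marker, which `h` excludes; any other
event moves marker `n` down or leaves it alone. -/
theorem mark_succ_le {n s : ℕ}
    (h : ∀ m < n, mark m (events a ν s) = mark m (events a ν (s + 1))) :
    mark n (events a ν (s + 1)) ≤ mark n (events a ν s) := by
  rcases events_succ_cases (a := a) (ν := ν) s with h' | ⟨-, h'⟩
  · rw [h']
  · have hself : mark (candidate a ν s).1 (events a ν (s + 1)) <
        mark (candidate a ν s).1 (events a ν s) := by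
      have h1 := moves_le (a := a) (ν := ν) (candidate a ν s).1 (s + 1)
      have h2 : moves (candidate a ν s).1 (events a ν (s + 1)) =
          moves (candidate a ν s).1 (events a ν s) + 1 := by
        rw [h', moves, List.filter_cons_of_pos (by simp), List.length_cons, moves]
      have h3 : resets (candidate a ν s).1 (events a ν (s + 1)) =
          resets (candidate a ν s).1 (events a ν s) := by
        rw [h', resets, List.filter_cons_of_neg (by simp), resets]
      rw [mark, mark, h3]
      simp only [room] at h1 ⊢
      omega
    rcases lt_trichotomy (candidate a ν s).1 n with hlt | heq | hgt
    · exact ((h _ hlt).not_gt hself).elim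
    · rw [← heq]
      exact hself.le
    · have h2 : moves n (events a ν (s + 1)) = moves n (events a ν s) := by
        rw [h', moves, List.filter_cons_of_neg (by simpa using hgt.ne'), moves]
      have h3 : resets n (events a ν (s + 1)) = resets n (events a ν s) := by
        rw [h', resets, List.filter_cons_of_neg (by simpa using hgt.le), resets]
      rw [mark, mark, h2, h3]

theorem eventually_eq_of_monotone_of_le {u : ℕ → ℕ} (hu : Monotone u) {B : ℕ}
    (hB : ∀ s, u s ≤ B) : ∃ l, ∀ᶠ s in atTop, u s = l := by
  obtain ⟨_, ⟨N, rfl⟩, hN⟩ := wellFounded_lt.has_min (Set.range fun s => B - u s) ⟨_, 0, rfl⟩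
  refine ⟨u N, ?_⟩
  filter_upwards [eventually_ge_atTop N] with s hs
  have h1 := hN _ ⟨s, rfl⟩
  have h2 := hu hs
  have h3 := hB s
  simp only at h1
  omega

variable (a ν) in
theorem exists_limit_mark : ∃ p : ℕ → ℕ,
    ∀ n, p n < width n ∧ ∀ᶠ s in atTop, mark n (events a ν s) = p n := by
  have : ∀ n, ∃ l, l < width n ∧ ∀ᶠ s in atTop, mark n (events a ν s) = l := by
    intro n
    obtain ⟨c, hc⟩ := eventually_eq_of_monotone_of_le
      (u := fun s => moves n (events a ν s)) (fun s t h => moves_mono h) (moves_le n)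
    obtain ⟨r, hr⟩ := eventually_eq_of_monotone_of_le
      (u := fun s => resets n (events a ν s)) (fun s t h => resets_mono h) (resets_le n)
    have hev : ∀ᶠ s in atTop, mark n (events a ν s) =
        r * room n (base n) + (room n (base n) - 1 - c) := by
      filter_upwards [hc, hr] with s h1 h2
      rw [mark, h1, h2]
    obtain ⟨s, hs⟩ := hev.exists
    exact ⟨_, hs ▸ mark_lt n s, hev⟩
  choose p hp using this
  exact ⟨p, hp⟩

/-! ### The final markers are cohesive for left-r.e. sets -/

/-- The element of block `n` at place `p`. -/
def markerPos (ν : Bool) (n p : ℕ) : ℕ := base n + mirror ν n (3 * p)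

/-- The set of all final markers. -/
def markerSet (ν : Bool) (p : ℕ → ℕ) : Set ℕ := {m | m = markerPos ν (blockOf m) (p (blockOf m))}

theorem base_le_markerPos (ν : Bool) (n p : ℕ) : base n ≤ markerPos ν n p := Nat.le_add_right _ _

theorem markerPos_add {ν : Bool} {n p : ℕ} (h : p < width n) :
    markerPos ν n p + 1 + digitsAfter ν n p = base (n + 1) := by
  rw [base_succ]
  cases ν <;> simp only [markerPos, mirror, digitsAfter, cond_true, cond_false] <;> omega

section

variable {a : ℕ → ℕ → ℕ → Bool} {ν : Bool} {α : ℕ → Set ℕ}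

theorem IsLeftApprox.eventually_eq {a : ℕ → ℕ → Bool} {A : Set ℕ} (h : IsLeftApprox a A)
    {F : ℕ → Bool} (hF : ∀ i, F i = true ↔ i ∈ A) (b : ℕ) :
    ∀ᶠ s in atTop, ∀ i < b, a s i = F i := by
  have : ∀ i ∈ Finset.range b, ∀ᶠ s in atTop, a s i = F i := fun i _ => by
    filter_upwards [h.2 i] with s hs
    rw [Bool.eq_iff_iff, hs, hF]
  simpa using (eventually_all_finset _).2 this

theorem IsLeftApprox.prefixVal_le {a : ℕ → ℕ → Bool} {A : Set ℕ} (h : IsLeftApprox a A)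
    {F : ℕ → Bool} (hF : ∀ i, F i = true ↔ i ∈ A) (s b : ℕ) :
    prefixVal (a s) b ≤ prefixVal F b := by
  have hmono : Monotone fun s => prefixVal (a s) b :=
    monotone_nat_of_le_succ fun s => prefixVal_le_of_lexLE (h.1 s) b
  obtain ⟨t, ht, hst⟩ := ((h.eventually_eq hF b).and (eventually_ge_atTop s)).exists
  rw [← prefixVal_congr ht]
  exact hmono hst

theorem exists_happens {s : ℕ} {ev : ℕ × ℕ × ℕ} (h : ev ∈ events a ν s) :
    ∃ t, happens a ν t (events a ν t) = true ∧ candidate a ν t = ev := by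
  induction s with
  | zero => simp [events] at h
  | succ s ih =>
    rcases events_succ_cases (a := a) (ν := ν) s with h' | ⟨h1, h'⟩
    · exact ih (h' ▸ h)
    · rw [h', List.mem_cons] at h
      rcases h with rfl | h
      · exact ⟨s, h1, rfl⟩
      · exact ih h

/-- The final configuration would itself trigger the event `(n, e, v)` unless it had already
happened. But the event sends marker `n + 1` to a higher place for good, while monotonicity of the
approximation keeps the final place at or below the one recorded by the event. -/
theorem false_of_split (ha : ∀ e, IsLeftApprox (a e) (α e)) {p : ℕ → ℕ}
    (hp : ∀ n, p n < width n ∧ ∀ᶠ s in atTop, mark n (events a ν s) = p n) {n e : ℕ}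
    (hen : e ≤ n) {F : ℕ → Bool} (hF : ∀ i, F i = true ↔ i ∈ α e)
    (hsplit : ∀ i, base n ≤ i → i < base (n + 2) →
      (xor (F i) ν = true ↔ i = markerPos ν (n + 1) (p (n + 1)))) : False := by
  set v := prefixVal (fun i => xor (F i) ν) (base n) with hv
  have hbase : base n < base (n + 1) := base_strictMono (Nat.lt_add_one n)
  have hfinal : prefixVal (fun i => xor (F i) ν) (base (n + 2)) =
      v * 2 ^ (base (n + 2) - base n) + 2 ^ digitsAfter ν (n + 1) (p (n + 1)) := by
    have h1 := markerPos_add (ν := ν) (hp (n + 1)).1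
    have h2 := base_le_markerPos ν (n + 1) (p (n + 1))
    have h3 := prefixVal_of_single (f := fun i => xor (F i) ν) (b := base n)
      (q := markerPos ν (n + 1) (p (n + 1))) (d := digitsAfter ν (n + 1) (p (n + 1)))
      (by omega) (by rw [h1]; exact hsplit)
    rwa [h1] at h3
  have hmem : ∃ s, (n, e, v) ∈ events a ν s := by
    obtain ⟨s₀, hs₀⟩ := eventually_atTop.1
      (((ha e).eventually_eq hF (base (n + 2))).and (hp (n + 1)).2)
    -- The second component of a stage is mere padding, so the pair `(n, e)` is examined at
    -- arbitrarily late stages.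
    obtain ⟨h1, h2⟩ := hs₀ (Nat.pair (Nat.pair n e) s₀) (Nat.right_le_pair _ _)
    have hval : ∀ b ≤ base (n + 2),
        prefixVal (fun i => xor (a e (Nat.pair (Nat.pair n e) s₀) i) ν) b =
          prefixVal (fun i => xor (F i) ν) b := fun b hb =>
      prefixVal_congr fun i hi => by rw [h1 i (by omega)]
    have hcand : candidate a ν (Nat.pair (Nat.pair n e) s₀) = (n, e, v) := by
      simp [candidate, hval _ (base_strictMono.monotone (by omega : n ≤ n + 2)), ← hv]
    by_cases hin : (n, e, v) ∈ events a ν (Nat.pair (Nat.pair n e) s₀)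
    · exact ⟨_, hin⟩
    · refine ⟨Nat.pair (Nat.pair n e) s₀ + 1, ?_⟩
      have hh : happens a ν (Nat.pair (Nat.pair n e) s₀)
          (events a ν (Nat.pair (Nat.pair n e) s₀)) = true := by
        rw [happens_iff, hcand]
        simp only [Nat.unpair_pair]
        exact ⟨hen, by rw [hval _ le_rfl, h2, hfinal], hin⟩
      rw [events_succ, hh, cond_true, hcand]
      exact List.mem_cons_self
  obtain ⟨s, hs⟩ := hmem
  obtain ⟨t, ht, hct⟩ := exists_happens hs
  obtain ⟨-, h2, -⟩ := happens_iff.1 ht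
  have h4 : t.unpair.1.unpair.1 = n := congrArg Prod.fst hct
  have h5 : t.unpair.1.unpair.2 = e := congrArg (fun ev => ev.2.1) hct
  rw [hct, h4, h5] at h2
  have hlt : mark (n + 1) (events a ν t) < p (n + 1) := by
    obtain ⟨u, hu, htu⟩ := ((hp (n + 1)).2.and (eventually_ge_atTop (t + 1))).exists
    rw [← hu]
    refine mark_lt_mark (lt_of_lt_of_le ?_ (resets_mono htu))
    rw [events_succ, ht, cond_true, hct, resets, resets, List.filter_cons_of_pos (by simp),
      List.length_cons]
    exact Nat.lt_add_one _
  have hwidth := (hp (n + 1)).1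
  -- Prefix values of the approximation only grow. For `ν = true` those of its complement only
  -- shrink, but in reversed blocks a higher place has more digits after it, so both cases end in
  -- the same contradiction.
  cases ν
  · have h6 := (ha e).prefixVal_le hF t (base (n + 2))
    simp only [Bool.xor_false] at h2 hfinal
    rw [h2, hfinal] at h6
    have h7 := (Nat.pow_le_pow_iff_right (by omega : 1 < 2)).1 (Nat.le_of_add_le_add_left h6)
    simp only [digitsAfter, cond_false] at h7
    omega
  · have h6 := (ha e).prefixVal_le hF t (base (n + 2))
    have h7 := prefixVal_not (a e t) (base (n + 2))
    have h8 := prefixVal_not F (base (n + 2))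
    simp only [Bool.xor_true] at h2 hfinal
    rw [h2] at h7
    rw [hfinal] at h8
    have h9 : 2 ^ digitsAfter true (n + 1) (p (n + 1)) ≤
        2 ^ digitsAfter true (n + 1) (mark (n + 1) (events a true t)) := by
      omega
    have h10 := (Nat.pow_le_pow_iff_right (by omega : 1 < 2)).1 h9
    simp only [digitsAfter, cond_true] at h10
    omega

theorem finite_markerSet_diff (ha : ∀ e, IsLeftApprox (a e) (α e)) {p : ℕ → ℕ}
    (hp : ∀ n, p n < width n ∧ ∀ᶠ s in atTop, mark n (events a ν s) = p n) {e : ℕ}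
    {F : ℕ → Bool} (hF : ∀ i, F i = true ↔ i ∈ α e)
    (hsub : ({i | xor (F i) ν = true} \ markerSet ν p).Finite)
    (hinf : {i | xor (F i) ν = true}.Infinite) :
    (markerSet ν p \ {i | xor (F i) ν = true}).Finite := by
  by_contra hdiff
  have hw := fun n => (hp n).1
  obtain ⟨N, hN⟩ := hsub.bddAbove
  -- So far out, a block index `n` satisfies `e ≤ n`, as events require, and `base n > N`, so that
  -- from there on the set contains only markers.
  obtain ⟨m₁, ⟨hm₁, hm₁'⟩, hlt₁⟩ := Set.Infinite.exists_gt hdiff (base (N + e + 1))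
  have hb₁ : N + e + 1 ≤ blockOf m₁ := by
    have := base_strictMono.lt_iff_lt.1 (hlt₁.trans (base_blockOf m₁).2)
    omega
  obtain ⟨m₂, hm₂, hlt₂⟩ := hinf.exists_gt (base (blockOf m₁ + 1) + N)
  have hb₂ : blockOf m₁ < blockOf m₂ := by
    have := base_strictMono.lt_iff_lt.1
      ((Nat.le_add_right _ _).trans_lt (hlt₂.trans (base_blockOf m₂).2))
    omega
  have hm₂' : m₂ ∈ markerSet ν p := by
    by_contra h
    have : m₂ ≤ N := hN ⟨hm₂, h⟩
    omega
  -- The marker `m₁` is left out and the later marker `m₂` is not, so between them some omitted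
  -- marker is directly followed by an included one.
  obtain ⟨n, hn, hnot, hyes⟩ : ∃ n, blockOf m₁ ≤ n ∧
      ¬ xor (F (markerPos ν n (p n))) ν = true ∧
      xor (F (markerPos ν (n + 1) (p (n + 1)))) ν = true := by
    by_contra! hstep
    have hall : ∀ n, blockOf m₁ ≤ n → ¬ xor (F (markerPos ν n (p n))) ν = true := by
      intro n hn
      induction n, hn using Nat.le_induction with
      | base =>
        rw [← show m₁ = markerPos ν (blockOf m₁) (p (blockOf m₁)) from hm₁]
        exact hm₁'
      | succ n hn ih => exact hstep n hn ih
    refine hall _ hb₂.le ?_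
    rw [← show m₂ = markerPos ν (blockOf m₂) (p (blockOf m₂)) from hm₂']
    exact hm₂
  refine false_of_split ha hp (by omega : e ≤ n) hF fun i hi hi' => ⟨fun h => ?_, ?_⟩
  · have hmem : i ∈ markerSet ν p := by
      by_contra h'
      have h1 : i ≤ N := hN ⟨h, h'⟩
      have h2 := le_base n
      omega
    have hi'' : i = markerPos ν (blockOf i) (p (blockOf i)) := hmem
    rcases lt_or_ge i (base (n + 1)) with h1 | h1
    · rw [blockOf_eq hi h1] at hi''
      exact (hnot (hi'' ▸ h)).elim
    · rwa [blockOf_eq h1 hi'] at hi''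
  · rintro rfl
    exact hyes

end

/-! ### The index sets are `Σ₃`-hard -/

section

variable {ν k : Bool} {w : ℕ → Bool} {p : ℕ → ℕ}

theorem xor_blockSet (m : ℕ) : xor (blockSet ν k w p m) ν =
    contents k (w (blockOf m)) (p (blockOf m)) (mirror ν (blockOf m) (m - base (blockOf m))) := by
  simp [blockSet]

theorem xor_blockSet_add_mirror {n j : ℕ} (hj : j < 3 * width n) :
    xor (blockSet ν k w p (base n + mirror ν n j)) ν = contents k (w n) (p n) j := by
  rw [xor_blockSet, blockOf_add (mirror_lt hj), Nat.add_sub_cancel_left, mirror_mirror hj]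

theorem xor_blockSet_iff_of_true (hp : ∀ n, p n < width n) {m : ℕ} (hm : w (blockOf m) = true) :
    (xor (blockSet ν k w p m) ν = true ↔ m ∈ markerSet ν p) := by
  obtain ⟨h1, h2⟩ := base_blockOf m
  rw [base_succ] at h2
  have hpm := hp (blockOf m)
  rw [xor_blockSet, contents, hm, cond_true, beq_iff_eq]
  change _ ↔ m = base (blockOf m) + mirror ν (blockOf m) (3 * p (blockOf m))
  constructor
  · intro h
    rw [← h, mirror_mirror (by omega)]
    omega
  · intro h
    rw [show m - base (blockOf m) = mirror ν (blockOf m) (3 * p (blockOf m)) by omega,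
      mirror_mirror (by omega)]

/-- Up to complementation, a block set whose blocks are almost all of the first kind is almost
equal to the set of markers. -/
theorem finite_symmDiff_markerSet (hp : ∀ n, p n < width n) (hw : {n | w n = false}.Finite) :
    (symmDiff {m | xor (blockSet ν k w p m) ν = true} (markerSet ν p)).Finite := by
  refine (hw.biUnion fun n _ => Set.finite_Iio (base (n + 1))).subset fun m hm => ?_
  simp only [Set.mem_iUnion, exists_prop]
  refine ⟨blockOf m, ?_, (base_blockOf m).2⟩
  by_contra hne
  have h := xor_blockSet_iff_of_true (k := k) (ν := ν) hp
    (Bool.eq_true_of_not_eq_false (b := w (blockOf m)) hne)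
  rw [Set.mem_symmDiff] at hm
  simp only [Set.mem_ofPred_eq] at hm
  tauto

theorem infinite_of_section {A : Set ℕ} {I : Set ℕ} (hI : I.Infinite) {j : ℕ → ℕ}
    (hj : ∀ n ∈ I, j n < 3 * width n) (h : ∀ n ∈ I, base n + mirror ν n (j n) ∈ A) :
    A.Infinite := by
  refine (hI.image (f := fun n => base n + mirror ν n (j n)) fun n hn n' hn' heq => ?_).mono ?_
  · have := congrArg blockOf heq
    simpa only [blockOf_add (mirror_lt (hj n hn)), blockOf_add (mirror_lt (hj n' hn'))] using this
  · rintro _ ⟨n, hn, rfl⟩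
    exact h n hn

theorem infinite_xor_blockSet (hp : ∀ n, p n < width n) :
    {m | xor (blockSet ν k w p m) ν = true}.Infinite := by
  refine infinite_of_section (ν := ν) (I := Set.univ) Set.infinite_univ
    (j := fun n => bif w n then 3 * p n else 3 * p n + 1) (fun n _ => ?_) fun n _ => ?_
  · have := hp n
    cases w n <;> simp only [cond_true, cond_false] <;> omega
  · have := hp n
    change xor (blockSet ν k w p _) ν = true
    rw [xor_blockSet_add_mirror (by cases w n <;> simp only [cond_true, cond_false] <;> omega)]
    cases h : w n <;> simp [contents]

theorem xor_blockSet_mono {m : ℕ} (h : xor (blockSet ν false w p m) ν = true) :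
    xor (blockSet ν true w p m) ν = true := by
  rw [xor_blockSet] at h ⊢
  revert h
  cases w (blockOf m) <;> simp [contents]
  intro h
  simp [h]

theorem infinite_xor_blockSet_diff (hp : ∀ n, p n < width n) (hw : {n | w n = false}.Infinite) :
    {m | xor (blockSet ν true w p m) ν = true ∧
      ¬ xor (blockSet ν false w p m) ν = true}.Infinite := by
  refine infinite_of_section (ν := ν) hw (j := fun n => 3 * p n + 2) (fun n _ => ?_) fun n hn => ?_
  · have := hp n
    omega
  · have := hp n
    change xor (blockSet ν true w p _) ν = true ∧ ¬ xor (blockSet ν false w p _) ν = true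
    rw [xor_blockSet_add_mirror (by omega), xor_blockSet_add_mirror (by omega),
      show w n = false from hn]
    simp [contents]

end

/-- The minimal left-r.e. sets or, if `ν` is true, the maximal ones. -/
def extremalLeftRE (ν : Bool) : Set (Set ℕ) := bif ν then maximalLeftRE else minimalLeftRE

/-- Up to complementation the set is almost equal to the set of markers, so an intermediate
left-r.e. set would contradict `finite_markerSet_diff`. -/
theorem blockSet_mem_extremalLeftRE {a : ℕ → ℕ → ℕ → Bool} {α : ℕ → Set ℕ} {ν : Bool}
    (ha : ∀ e, IsLeftApprox (a e) (α e)) (hα : ∀ A, IsLeftRE A → ∃ e, α e = A) {p : ℕ → ℕ}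
    (hp : ∀ n, p n < width n ∧ ∀ᶠ s in atTop, mark n (events a ν s) = p n) {w : ℕ → Bool}
    (hw : {n | w n = false}.Finite) (hre : IsLeftRE {m | blockSet ν true w p m = true}) :
    {m | blockSet ν true w p m = true} ∈ extremalLeftRE ν := by
  classical
  have hw' := fun n => (hp n).1
  have hinf := infinite_xor_blockSet (ν := ν) (k := true) (w := w) hw'
  have hsd := finite_symmDiff_markerSet (ν := ν) (k := true) hw' hw
  set X := {m | blockSet ν true w p m = true} with hX
  set Y := {m | xor (blockSet ν true w p m) ν = true} with hY
  set M := markerSet ν p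
  have hYM : (Y \ M).Finite := hsd.subset fun x hx => .inl hx
  have key : ∀ E, IsLeftRE E → ∀ D, (∀ i, i ∈ D ↔ xor (decide (i ∈ E)) ν = true) →
      (D \ M).Finite → D.Infinite → (M \ D).Finite := by
    intro E hE D hD h1 h2
    obtain ⟨e, rfl⟩ := hα E hE
    have hDeq : D = {i | xor (decide (i ∈ α e)) ν = true} := Set.ext hD
    subst hDeq
    exact finite_markerSet_diff ha hp (e := e) (F := fun i => decide (i ∈ α e)) (by simp) h1 h2
  cases ν
  · have hXY : X = Y := by simp [hX, hY]
    refine ⟨hre, ⟨by simp, by simpa [hXY] using hinf⟩, ?_⟩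
    rintro ⟨E, hE, ⟨-, hE1⟩, hE2, hE3⟩
    rw [hXY] at hE2 hE3
    refine hE3 ((hYM.union (key E hE E (by simp) ?_ (by simpa using hE1))).subset ?_)
    · refine (hE2.union hYM).subset fun x hx => ?_
      by_cases hxY : x ∈ Y
      exacts [.inr ⟨hxY, hx.2⟩, .inl ⟨hx.1, hxY⟩]
    · intro x hx
      by_cases hxM : x ∈ M
      exacts [.inr ⟨hxM, hx.2⟩, .inl ⟨hx.1, hxM⟩]
  · have hXY : X = Yᶜ := by
      ext m
      simp [hX, hY]
    refine ⟨hre, ⟨by simp, by simpa [hXY, Set.sdiff_eq] using hinf⟩, ?_⟩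
    rintro ⟨E, hE, ⟨hE1, hE2⟩, -, hE3⟩
    rw [hXY] at hE1 hE2
    refine hE2 ((hYM.union (key E hE Eᶜ (by simp) ?_ (by simpa [Set.sdiff_eq] using hE3))).subset ?_)
    · refine (hE1.union hYM).subset fun x hx => ?_
      by_cases hxY : x ∈ Y
      exacts [.inr ⟨hxY, hx.2⟩, .inl ⟨hxY, hx.1⟩]
    · rintro x ⟨hxE, hxY⟩
      have hxY' : x ∈ Y := not_not.1 hxY
      by_cases hxM : x ∈ M
      exacts [.inr ⟨hxM, not_not.2 hxE⟩, .inl ⟨hxY', hxM⟩]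

/-- The version with `k = false` is the intermediate set: it still has an element in each block, but
lacks the second element of infinitely many pairs. -/
theorem blockSet_notMem_extremalLeftRE {ν : Bool} {p : ℕ → ℕ} (hp : ∀ n, p n < width n)
    {w : ℕ → Bool} (hw : {n | w n = false}.Infinite)
    (hre : IsLeftRE {m | blockSet ν false w p m = true}) :
    {m | blockSet ν true w p m = true} ∉ extremalLeftRE ν := by
  have h1 := infinite_xor_blockSet (ν := ν) (k := false) (w := w) hp
  have h2 := infinite_xor_blockSet_diff (ν := ν) hp hw
  have h3 : ∀ {m}, xor (blockSet ν false w p m) ν = true → xor (blockSet ν true w p m) ν = true :=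
    fun h => xor_blockSet_mono h
  cases ν
  · simp only [Bool.xor_false] at h1 h2 h3
    rintro ⟨-, -, hno⟩
    refine hno ⟨_, hre, ⟨by simp, by simpa using h1⟩, ?_, h2⟩
    exact Set.finite_empty.subset fun m hm => hm.2 (h3 hm.1)
  · simp only [Bool.xor_true, Bool.not_eq_true', Bool.not_eq_false] at h1 h2 h3
    rintro ⟨-, -, hno⟩
    refine hno ⟨_, hre, ⟨?_, h2.mono ?_⟩, by simp, ?_⟩
    · refine Set.finite_empty.subset fun m hm => ?_
      have hm' : ¬ blockSet true false w p m = true := hm.2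
      have := h3 (Bool.eq_false_iff.2 hm')
      exact Bool.false_ne_true (this.symm.trans hm.1)
    · rintro m ⟨hm, hm'⟩
      exact ⟨hm', by simp [hm]⟩
    · refine h1.mono fun m hm => ⟨trivial, ?_⟩
      have hm' : blockSet true false w p m = false := hm
      simp [hm']

theorem univSigma3_iff {e : ℕ} :
    UnivSigma3 e e ↔ ∃ x, {s | column e s = x}.Infinite := by
  simp only [infinite_column_iff]
  rfl

/-- The movement of the markers depends only on `a` and `ν` and is shared by all `e`. The index `e`
enters only through the deficiency set, which selects the kind of each block. -/
theorem exists_numbering {a : ℕ → ℕ → ℕ → Bool} {α : ℕ → Set ℕ}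
    (hac : Computable fun p : ℕ × ℕ × ℕ => a p.1 p.2.1 p.2.2)
    (ha : ∀ e, IsLeftApprox (a e) (α e)) (hα : ∀ A, IsLeftRE A → ∃ e, α e = A) (ν : Bool) :
    ∃ γ : ℕ → Set ℕ, IsLeftRENumbering γ ∧ ∀ e, γ e ∈ extremalLeftRE ν ↔ UnivSigma3 e e := by
  classical
  obtain ⟨p, hp⟩ := exists_limit_mark a ν
  let w : ℕ → ℕ → Bool := fun e n => decide (Deficient (column e) n)
  let g : Bool → ℕ → ℕ → ℕ → Bool := fun k e s m =>
    blockSet ν k (deficientApprox e s) (fun n => mark n (events a ν s)) m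
  have hgc : ∀ k, Computable fun q : ℕ × ℕ × ℕ => g k q.1 q.2.1 q.2.2 := by
    intro k
    refine computable_blockSet (w := fun q : ℕ × ℕ × ℕ => deficientApprox q.1 q.2.1)
      (p := fun (q : ℕ × ℕ × ℕ) n => mark n (events a ν q.2.1)) ?_ ?_ (by fun_prop)
    · exact computable_deficientApprox.comp (g := fun r : (ℕ × ℕ × ℕ) × ℕ =>
        (r.1.1, r.1.2.1, r.2)) (by fun_prop)
    · have := computable_events (ν := ν) hac (f := fun r : (ℕ × ℕ × ℕ) × ℕ => r.1.2.1)
        (by fun_prop)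
      fun_prop
  have hg : ∀ k e, IsLeftApprox (g k e) {m | blockSet ν k (w e) p m = true} := by
    intro k e
    refine ⟨fun s => lexLE_blockSet (fun n => deficientApprox_mono (Nat.le_succ s))
      (fun n => mark_lt n s) fun n => mark_succ_le, fun m => ?_⟩
    have hw : ∀ n, ∀ᶠ s in atTop, deficientApprox e s n = w e n := fun n => by
      filter_upwards [eventually_deficientApprox e n] with s hs
      rw [Bool.eq_iff_iff, hs, decide_eq_true_eq]
    filter_upwards [eventually_blockSet (ν := ν) (k := k) hw (fun n => (hp n).2) m] with s hs
    change blockSet ν k _ _ m = true ↔ blockSet ν k _ _ m = true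
    rw [hs]
  have hre : ∀ k e, IsLeftRE {m | blockSet ν k (w e) p m = true} := fun k e =>
    ⟨g k e, (hgc k).comp (g := fun q : ℕ × ℕ => (e, q.1, q.2)) (by fun_prop), hg k e⟩
  have hwset : ∀ e, {n | w e n = false} = {n | ¬ Deficient (column e) n} := fun e => by
    ext n
    simp [w]
  refine ⟨fun e => {m | blockSet ν true (w e) p m = true}, ⟨g true, hgc true, hg true⟩,
    fun e => ?_⟩
  rw [univSigma3_iff]
  by_cases h : ∃ x, {s | column e s = x}.Infinite
  · exact iff_of_true (blockSet_mem_extremalLeftRE ha hα hp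
      (hwset e ▸ finite_not_deficient h) (hre true e)) h
  · exact iff_of_false (blockSet_notMem_extremalLeftRE (fun n => (hp n).1)
      (hwset e ▸ infinite_not_deficient h) (hre false e)) h

/-- Equality of members of left-r.e. numberings is a `Π₂` property of the indices. -/
theorem isPi2_eq_of_numbering {α γ : ℕ → Set ℕ} (hα : IsLeftRENumbering α)
    (hγ : IsLeftRENumbering γ) : IsPi2 fun q : ℕ × ℕ => α q.2 = γ q.1 := by
  obtain ⟨a, hac, ha⟩ := hα
  obtain ⟨g, hgc, hg⟩ := hγ
  have h1 : IsPi2 fun r : ((ℕ × ℕ) × ℕ) × ℕ =>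
      ∃ d, (a r.1.1.2 (r.2 + d) r.1.2 == g r.1.1.1 (r.2 + d) r.1.2) = true := by
    refine IsPi2.exists_computable (f := fun t : (((ℕ × ℕ) × ℕ) × ℕ) × ℕ =>
      a t.1.1.1.2 (t.1.2 + t.2) t.1.1.2 == g t.1.1.1.1 (t.1.2 + t.2) t.1.1.2) ?_
    refine Primrec.beq.to_comp.comp ?_ ?_
    · exact hac.comp (g := fun t : (((ℕ × ℕ) × ℕ) × ℕ) × ℕ =>
        (t.1.1.1.2, t.1.2 + t.2, t.1.1.2)) (by fun_prop)
    · exact hgc.comp (g := fun t : (((ℕ × ℕ) × ℕ) × ℕ) × ℕ =>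
        (t.1.1.1.1, t.1.2 + t.2, t.1.1.2)) (by fun_prop)
  -- Both approximations converge at `m`, so agreement at infinitely many stages is the same as
  -- agreement of the limits.
  have h2 : ∀ q : ℕ × ℕ, α q.2 = γ q.1 ↔
      ∀ m s, ∃ d, (a q.2 (s + d) m == g q.1 (s + d) m) = true := by
    rintro ⟨e, d⟩
    have hev : ∀ m, ∀ᶠ s in atTop, ((a d s m == g e s m) = true ↔ (m ∈ α d ↔ m ∈ γ e)) := by
      intro m
      filter_upwards [(ha d).2 m, (hg e).2 m] with s h1 h2
      rw [beq_iff_eq, Bool.eq_iff_iff, h1, h2]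
    rw [Set.ext_iff]
    refine forall_congr' fun m => ?_
    obtain ⟨t, ht⟩ := eventually_atTop.1 (hev m)
    constructor
    · exact fun h s => ⟨t, (ht _ (by omega)).2 h⟩
    · intro h
      obtain ⟨i, hi⟩ := h t
      exact (ht _ (by omega)).1 hi
  have h3 := h1.all.all
  rwa [funext fun q => propext (h2 q)]

/-- No recursive translation of γ-indices into α-indices is available for an arbitrary universal α.
Guessing an α-index and checking it by a Π₂ condition costs nothing at the Σ₃ level. -/
theorem not_isSigma3_notMem_indexSet {α : ℕ → Set ℕ} (hα : IsUniversalNumbering α) (ν : Bool) :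
    ¬ IsSigma3 fun d => d ∉ indexSet α (extremalLeftRE ν) := by
  intro h
  obtain ⟨⟨a, hac, ha⟩, huniv⟩ := id hα
  obtain ⟨γ, hγ, hγe⟩ := exists_numbering hac ha huniv ν
  refine not_isSigma3_not_univSigma3 ?_
  have h1 := ((isPi2_eq_of_numbering hα.1 hγ).isSigma3.and
    (h.comp (f := fun q : ℕ × ℕ => q.2) (by fun_prop))).ex
  refine h1.congr fun e => ?_
  rw [← hγe]
  constructor
  · intro he
    obtain ⟨g, hgc, hg⟩ := hγ
    obtain ⟨d, hd⟩ := huniv (γ e)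
      ⟨g e, hgc.comp (g := fun q : ℕ × ℕ => (e, q.1, q.2)) (by fun_prop), hg e⟩
    refine ⟨d, hd, ?_⟩
    change α d ∉ extremalLeftRE ν
    rwa [hd]
  · rintro ⟨d, hd, hd'⟩ he
    refine hd' ?_
    change α d ∈ extremalLeftRE ν
    rwa [show α d = γ e from hd]

theorem not_isLeftRE_indexSet {α : ℕ → Set ℕ} (hα : IsUniversalNumbering α) (ν : Bool) :
    ¬ IsLeftRE (indexSet α (extremalLeftRE ν)) := fun h =>
  not_isSigma3_notMem_indexSet hα ν (isSigma3_notMem_of_isLeftRE h)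

end LeftRE

theorem mainTheorem11 :
    (∀ α : ℕ → Set ℕ, LeftRE.IsUniversalNumbering α →
      ∀ S : Set ℕ,
        (S = LeftRE.indexSet α LeftRE.minimalLeftRE ∨
          S = LeftRE.indexSet α LeftRE.maximalLeftRE) →
        ¬ LeftRE.RecursiveInSet S (LeftRE.jump LeftRE.K) ∧
        ¬ LeftRE.IsLeftRE S ∧
        S ∉ LeftRE.minimalLeftRE ∧
        S ∉ LeftRE.maximalLeftRE) ∧
    ¬ LeftRE.CanBeMadeIntoItself LeftRE.minimalLeftRE ∧
    ¬ LeftRE.CanBeMadeIntoItself LeftRE.maximalLeftRE := by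
  refine ⟨fun α hα S hS => ?_, ?_, ?_⟩
  · obtain ⟨ν, rfl⟩ : ∃ ν, S = LeftRE.indexSet α (LeftRE.extremalLeftRE ν) := by
      rcases hS with h | h
      exacts [⟨false, h⟩, ⟨true, h⟩]
    have h := LeftRE.not_isLeftRE_indexSet hα ν
    exact ⟨fun h' => LeftRE.not_isSigma3_notMem_indexSet hα ν
      (LeftRE.isSigma3_notMem_of_recursiveInSet h'), h, fun h' => h h'.1, fun h' => h h'.1⟩
  · rintro ⟨β, hβ, h⟩
    exact LeftRE.not_isLeftRE_indexSet hβ false h.1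
  · rintro ⟨β, hβ, h⟩
    exact LeftRE.not_isLeftRE_indexSet hβ true h.1
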